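/- Let $d\in\mathbb N$, $\alpha,\beta>0$ and $g\in L^2(\mathbb R^d)$. Let $\mathcal G(g,\alpha,\beta)=\{\pi(\alpha k,\beta l)g : k,l\in\mathbb Z^d\}$, where $\pi(x,\xi)g(t)=e^{2\pi i\xi\cdot t}g(t-x)$; it is called a frame for $L^2(\mathbb R^d)$ if there are constants $A,B>0$ with $$A\|f\|_2^2\le\sum_{k,l\in\mathbb Z^d}|\langle f,\pi(\alpha k,\beta l)g\rangle|^2\le B\|f\|_2^2\qquad\text{for all } f\in L^2(\mathbb R^d).$$ For $a>0$ let $$Z_a g(x,\xi)=\sum_{k\in\mathbb Z^d}g(x-ak)\,e^{2\pi i a k\cdot\xi}$$ be the Zak transform of $g$. For almost every $x$ the coefficients $(g(x-ak))_{k}$ lie in $\ell^2(\mathbb Z^d)$, and the series is understood as a Fourier series converging in $L^2$ over a period cube of the variable $\xi$; $Z_a g$ denotes a jointly measurable function on $\mathbb R^d\times\mathbb R^d$ representing these sums, which is unique up to null sets. **Theorem (Zeevi--Zibulski criterion for rational lattices).** Suppose that $\alpha\beta=p/q\le 1$ with positive integers $p,q$. For $x,\xi\in\mathbb R^d$ let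 $\mathcal Q(x,\xi)$ be the $q^d\times p^d$ matrix with entries $$\mathcal Q(x,\xi)_{r,s}=Z_{1/\beta}\,g\Big(x+\frac{p}{\beta q}\,r,\ \beta\xi+\frac{\beta}{p}\,s\Big),\qquad r\in\{0,\dots,q-1\}^d,\ s\in\{0,\dots,p-1\}^d.$$ Then $\mathcal G(g,\alpha,\beta)$ is a frame for $L^2(\mathbb R^d)$ if and only if there are constants $0<A\le B<\infty$ such that, for almost all $(x,\xi)\in\mathbb R^d\times\mathbb R^d$, all $p^d$ singular values of $\mathcal Q(x,\xi)$ (the square roots of the eigenvalues of $\mathcal Q(x,\xi)^*\mathcal Q(x,\xi)$) lie in $[A^{1/2},B^{1/2}]$. -/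

import Mathlib

open MeasureTheory Filter Topology
open scoped ENNReal

noncomputable section

namespace GaborRational

/-- The space `ℝᵈ`. -/
abbrev RSpace (d : ℕ) : Type := EuclideanSpace ℝ (Fin d)

/-- The Hilbert space `L²(ℝᵈ)`. -/
abbrev L2 (d : ℕ) : Type := Lp ℂ 2 (volume : Measure (RSpace d))

/-- The inclusion `ℤᵈ ⊆ ℝᵈ`. -/
def intVec {d : ℕ} (k : Fin d → ℤ) : RSpace d := WithLp.toLp 2 fun i => (k i : ℝ)

/-- The inclusion `{0, …, n-1}ᵈ ⊆ ℝᵈ`. -/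
def finVec {d n : ℕ} (r : Fin d → Fin n) : RSpace d := WithLp.toLp 2 fun i => ((r i : ℕ) : ℝ)

/-! ### Frames and Gabor systems -/

/-- A family in a Hilbert space is a frame if it satisfies the two-sided frame inequality
with some positive constants; convergence of the series is part of the condition. -/
def IsFrame {ι H : Type*} [NormedAddCommGroup H] [InnerProductSpace ℂ H] (φ : ι → H) : Prop :=
  ∃ A B : ℝ, 0 < A ∧ 0 < B ∧ ∀ f : H,
    Summable (fun i => ‖inner ℂ f (φ i)‖ ^ 2) ∧
    A * ‖f‖ ^ 2 ≤ ∑' i, ‖inner ℂ f (φ i)‖ ^ 2 ∧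
    ∑' i, ‖inner ℂ f (φ i)‖ ^ 2 ≤ B * ‖f‖ ^ 2

/-- The function `t ↦ e^{2πi ξ·t} g(t - x)`. -/
def tfShiftFun {d : ℕ} (x ξ : RSpace d) (g : RSpace d → ℂ) (t : RSpace d) : ℂ :=
  Complex.exp (2 * Real.pi * Complex.I * ((inner ℝ ξ t : ℝ) : ℂ)) * g (t - x)

theorem memLp_tfShiftFun {d : ℕ} (x ξ : RSpace d) (g : L2 d) :
    MemLp (tfShiftFun x ξ g) 2 (volume : Measure (RSpace d)) := by
  have h1 : MemLp (fun t => g (t - x)) 2 (volume : Measure (RSpace d)) :=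
    (Lp.memLp g).comp_measurePreserving (measurePreserving_sub_right volume x)
  refine h1.of_le (((Continuous.aestronglyMeasurable (by fun_prop)).mul h1.1)) ?_
  refine Eventually.of_forall fun t => ?_
  have : ‖Complex.exp (2 * Real.pi * Complex.I * ((inner ℝ ξ t : ℝ) : ℂ))‖ = 1 := by
    rw [show (2 * Real.pi * Complex.I * ((inner ℝ ξ t : ℝ) : ℂ))
      = ((2 * Real.pi * inner ℝ ξ t : ℝ) : ℂ) * Complex.I by push_cast; ring]
    exact Complex.norm_exp_ofReal_mul_I _
  simp [tfShiftFun, this]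

/-- The time-frequency shift `π(x, ξ) g = e^{2πi ξ·t} g(t - x)` as an element of `L²(ℝᵈ)`. -/
def tfShift {d : ℕ} (x ξ : RSpace d) (g : L2 d) : L2 d :=
  (memLp_tfShiftFun x ξ g).toLp (tfShiftFun x ξ g)

/-- The Gabor system `G(g, α, β) = {π(αk, βl) g : k, l ∈ ℤᵈ}` over the lattice `αℤᵈ × βℤᵈ`. -/
def gaborSystem {d : ℕ} (g : L2 d) (α β : ℝ) (kl : (Fin d → ℤ) × (Fin d → ℤ)) : L2 d :=
  tfShift (α • intVec kl.1) (β • intVec kl.2) g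

/-! ### The Zak transform

For `f ∈ L²(ℝᵈ)` and `a > 0`, the coefficients `(f (x - a k))ₖ` are square summable for almost
every `x`, and the series `∑ₖ f (x - a k) e^{2πi a k·ξ}` is understood as a Fourier series
in the variable `θ = a ξ mod ℤᵈ`, convergent in `L²` of the torus. -/

/-- Normalised Haar measure on the torus `(ℝ/ℤ)ᵈ`. -/
abbrev torusMeasure (d : ℕ) : Measure (UnitAddTorus (Fin d)) :=
  Measure.pi fun _ => AddCircle.haarAddCircle

/-- The exponential `θ ↦ e^{2πi k·θ}` as an element of `L²((ℝ/ℤ)ᵈ)`. -/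
def torusExp {d : ℕ} (k : Fin d → ℤ) : Lp ℂ 2 (torusMeasure d) :=
  ContinuousMap.toLp 2 (torusMeasure d) ℂ (UnitAddTorus.mFourier k)

/-- The sum in `L²((ℝ/ℤ)ᵈ)` of the Fourier series with coefficients `f (x - a k)`. -/
def zakFiber {d : ℕ} (a : ℝ) (f : L2 d) (x : RSpace d) : Lp ℂ 2 (torusMeasure d) :=
  ∑' k : Fin d → ℤ, f (x - a • intVec k) • torusExp k

theorem stronglyMeasurable_zakFiber {d : ℕ} (a : ℝ) (f : L2 d) :
    StronglyMeasurable (zakFiber a f) := by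
  classical
  let P : Finset (Fin d → ℤ) → RSpace d → Lp ℂ 2 (torusMeasure d) :=
    fun s x => ∑ k ∈ s, f (x - a • intVec k) • torusExp k
  have hP : ∀ s, StronglyMeasurable (P s) := fun s =>
    Finset.stronglyMeasurable_fun_sum s fun k _ =>
      ((Lp.stronglyMeasurable f).comp_measurable (measurable_id.sub_const _)).smul_const _
  have hS := StronglyMeasurable.measurableSet_exists_tendsto (l := atTop) hP
  have hL := (StronglyMeasurable.limUnder (l := atTop) hP).indicator hS
  convert hL using 1
  funext x
  by_cases hx : ∃ c, Tendsto (P · x) atTop (𝓝 c)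
  · rw [Set.indicator_of_mem (show x ∈ {x | ∃ c, Tendsto (P · x) atTop (𝓝 c)} from hx)]
    obtain ⟨c, hc⟩ := hx
    rw [hc.limUnder_eq]
    exact HasSum.tsum_eq hc
  · rw [Set.indicator_of_notMem (show x ∉ {x | ∃ c, Tendsto (P · x) atTop (𝓝 c)} from hx)]
    exact tsum_eq_zero_of_not_summable fun ⟨c, hc⟩ => hx ⟨c, hc⟩

/-- A strongly measurable family of `L²` functions has a jointly measurable representative. -/
theorem exists_jointly_measurable_representative {X T : Type*} [MeasurableSpace X]
    [MeasurableSpace T] {μ : Measure T} {F : X → Lp ℂ 2 μ} (hF : StronglyMeasurable F) :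
    ∃ Z : X × T → ℂ, StronglyMeasurable Z ∧ ∀ x, (fun t => Z (x, t)) =ᵐ[μ] F x := by
  classical
  rcases isEmpty_or_nonempty X with hX | hX
  · exact ⟨0, stronglyMeasurable_zero, fun x => isEmptyElim x⟩
  obtain ⟨c, hc, hcF⟩ := hF.isSeparable_range
  have hcne : c.Nonempty := by
    obtain ⟨x⟩ := hX
    have := hcF (Set.mem_range_self x)
    exact closure_nonempty_iff.1 ⟨_, this⟩
  obtain ⟨u, rfl⟩ := hc.exists_eq_range hcne
  have hex : ∀ n : ℕ, ∀ x, ∃ k, dist (F x) (u k) < (1 / 2) ^ n := by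
    intro n x
    obtain ⟨_, ⟨k, rfl⟩, hk⟩ := Metric.mem_closure_iff.1 (hcF (Set.mem_range_self x))
      ((1 / 2) ^ n) (by positivity)
    exact ⟨k, hk⟩
  let N : ℕ → X → ℕ := fun n x => Nat.find (hex n x)
  have hN : ∀ n, Measurable (N n) := fun n => by
    refine measurable_find (hex n) fun k => ?_
    exact (hF.dist stronglyMeasurable_const).measurable measurableSet_Iio
  have hNspec : ∀ n x, dist (F x) (u (N n x)) < (1 / 2) ^ n := fun n x => Nat.find_spec (hex n x)
  let G : ℕ → X × T → ℂ := fun n p => u (N n p.1) p.2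
  have hG : ∀ n, StronglyMeasurable (G n) := fun n => by
    have h1 : Measurable fun q : ℕ × T => (u q.1 : T → ℂ) q.2 :=
      measurable_from_prod_countable_right fun k => (Lp.stronglyMeasurable (u k)).measurable
    exact (h1.comp (((hN n).comp measurable_fst).prodMk measurable_snd)).stronglyMeasurable
  refine ⟨fun p => limUnder atTop (G · p), StronglyMeasurable.limUnder hG, fun x => ?_⟩
  have hnorm : ∀ n, eLpNorm (fun t => G n (x, t) - F x t) 2 μ ≤ ENNReal.ofReal ((1 / 2) ^ n) := by
    intro n
    have h1 : eLpNorm (fun t => G n (x, t) - F x t) 2 μ = edist (u (N n x)) (F x) := by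
      rw [Lp.edist_def]; rfl
    rw [h1, edist_comm, edist_dist]
    exact ENNReal.ofReal_le_ofReal (hNspec n x).le
  have hmeas : ∀ n, AEStronglyMeasurable (fun t => G n (x, t)) μ := fun n =>
    (Lp.stronglyMeasurable (u (N n x))).aestronglyMeasurable
  have hlim0 : Tendsto (fun n : ℕ => ENNReal.ofReal ((1 / 2 : ℝ) ^ n)) atTop (𝓝 0) := by
    have := ENNReal.tendsto_ofReal
      (tendsto_pow_atTop_nhds_zero_of_lt_one (by norm_num : (0 : ℝ) ≤ 1 / 2) (by norm_num))
    simpa using this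
  have hconv : ∀ᵐ t ∂μ, ∃ l : ℂ, Tendsto (fun n => G n (x, t)) atTop (𝓝 l) := by
    refine Lp.ae_tendsto_of_cauchy_eLpNorm (p := 2) hmeas (by norm_num)
      (B := fun n => ENNReal.ofReal (4 * (1 / 2) ^ n)) ?_ ?_
    · rw [← ENNReal.ofReal_tsum_of_nonneg (fun n => by positivity)
        (summable_geometric_two.mul_left 4)]
      exact ENNReal.ofReal_ne_top
    · intro M n m hn hm
      have hle : ∀ j, M ≤ j → ENNReal.ofReal ((1 / 2 : ℝ) ^ j) ≤ ENNReal.ofReal ((1 / 2) ^ M) :=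
        fun j hj => ENNReal.ofReal_le_ofReal
          (pow_le_pow_of_le_one (by norm_num) (by norm_num) hj)
      have hF' := (Lp.stronglyMeasurable (F x)).aestronglyMeasurable (μ := μ)
      calc eLpNorm ((fun t => G n (x, t)) - fun t => G m (x, t)) 2 μ
          = eLpNorm ((fun t => G n (x, t) - F x t) - fun t => G m (x, t) - F x t) 2 μ := by
            congr 1; funext t; simp
        _ ≤ eLpNorm (fun t => G n (x, t) - F x t) 2 μ
              + eLpNorm (fun t => G m (x, t) - F x t) 2 μ :=
            eLpNorm_sub_le ((hmeas n).sub hF') ((hmeas m).sub hF') (by norm_num)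
        _ ≤ ENNReal.ofReal ((1 / 2) ^ M) + ENNReal.ofReal ((1 / 2) ^ M) :=
            add_le_add ((hnorm n).trans (hle n hn)) ((hnorm m).trans (hle m hm))
        _ = ENNReal.ofReal (2 * (1 / 2) ^ M) := by
            rw [← ENNReal.ofReal_add (by positivity) (by positivity)]; congr 1; ring
        _ < ENNReal.ofReal (4 * (1 / 2) ^ M) := by
            refine (ENNReal.ofReal_lt_ofReal_iff (by positivity)).2 ?_
            have : (0 : ℝ) < (1 / 2) ^ M := by positivity
            linarith
  have htm : TendstoInMeasure μ (fun n t => G n (x, t)) atTop (F x) :=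
    tendstoInMeasure_of_tendsto_eLpNorm (p := 2) (by norm_num) hmeas
      (Lp.stronglyMeasurable (F x)).aestronglyMeasurable
      (tendsto_of_tendsto_of_tendsto_of_le_of_le tendsto_const_nhds hlim0
        (fun _ => zero_le) hnorm)
  obtain ⟨ns, hns, hsub⟩ := htm.exists_seq_tendsto_ae
  filter_upwards [hconv, hsub] with t ⟨l, hl⟩ ht
  rw [hl.limUnder_eq]
  exact tendsto_nhds_unique (hl.comp hns.tendsto_atTop) ht

/-- A jointly measurable function on `ℝᵈ × (ℝ/ℤ)ᵈ` whose section at each `x` represents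
`zakFiber a f x`; these two properties determine it up to a null set of the product. -/
def zakTorus {d : ℕ} (a : ℝ) (f : L2 d) : RSpace d × UnitAddTorus (Fin d) → ℂ :=
  (exists_jointly_measurable_representative (stronglyMeasurable_zakFiber a f)).choose

theorem stronglyMeasurable_zakTorus {d : ℕ} (a : ℝ) (f : L2 d) :
    StronglyMeasurable (zakTorus a f) :=
  (exists_jointly_measurable_representative (stronglyMeasurable_zakFiber a f)).choose_spec.1

theorem zakTorus_ae_eq {d : ℕ} (a : ℝ) (f : L2 d) (x : RSpace d) :
    (fun θ => zakTorus a f (x, θ)) =ᵐ[torusMeasure d] zakFiber a f x :=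
  (exists_jointly_measurable_representative (stronglyMeasurable_zakFiber a f)).choose_spec.2 x

/-- The Zak transform `Z_a f (x, ξ) = ∑ₖ f (x - a k) e^{2πi a k·ξ}`. -/
def zak {d : ℕ} (a : ℝ) (f : L2 d) (x ξ : RSpace d) : ℂ :=
  zakTorus a f (x, fun i => ((a * ξ i : ℝ) : UnitAddCircle))

/-! ### The matrices of the rational case -/

/-- The `q^d × p^d` matrix with entries `Z_{1/β} g (x + (p/(βq)) r, βξ + (β/p) s)`, with
`r ∈ {0, …, q-1}ᵈ` and `s ∈ {0, …, p-1}ᵈ`. -/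
def zzMatrix {d : ℕ} (g : L2 d) (β : ℝ) (p q : ℕ) (x ξ : RSpace d) :
    Matrix (Fin d → Fin q) (Fin d → Fin p) ℂ :=
  fun r s => zak (1 / β) g (x + ((p : ℝ) / (β * q)) • finVec r) (β • ξ + (β / p) • finVec s)

end GaborRational

end

noncomputable section

namespace GaborRational

/-! Put `a = 1/β`, so that `α q = a p`. Cut `ℝᵈ` into cubes of side `a` and write a point as `tile a
(j, y)`, with `j` the cube and `y` a torus variable. The modulations by `βl` are `a`-periodic, so
`⟨f, π(αk, βl)g⟩` is, up to the factor `a^d`, the Fourier coefficient of index `-l` of the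
correlation `tileCorr` of `f` with the translate of `g` by `αk`. Parseval in `l` turns the frame sum
into integrals of the squares of these correlations. The correlation is only known to be integrable,
hence the version of Parseval in `[0, ∞]` for `L¹` functions, `tsum_enorm_sq_mFourierCoeff`.

Write `k = qm - r`, so that `αk = a p m - αr`. Then the correlation is the Fourier coefficient of
index `pm` of the product of the conjugate of `Z f(x, ·)` with `Z g(x + αr, ·)`. The coefficients
with index in `pℤᵈ` are those of the sum over the translates by `s/p`
(`tsum_enorm_sq_mFourierCoeff_smul`). With `κ = a^d / p^d`, the frame sum is thus `κ²` times the
integral over one tile and the torus of the squared norm of the Zak matrix applied to the conjugated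
vector `(Z f(x, θ + s/p))_s`, while `‖f‖²` is `κ` times the integral of the squared norm of that
vector.

Pointwise bounds on the matrix integrate to the frame inequality. Conversely, every bounded
measurable function on a tile times the torus is the Zak transform of some `f`
(`exists_zakTile_ae_eq`), so the integrated inequality may be tested on enough functions to recover
the pointwise one (`ae_matrixBound`). Two-sided norm bounds of a matrix are bounds on its singular
values, by diagonalising `T* T` (`singularValues_mem_Icc_iff`). -/

/-! ### Tiling `ℝᵈ` by the translates of a period cube -/

/-- The representative in `(0, 1]` of a point of the circle. -/
def circleRep (y : UnitAddCircle) : ℝ := (AddCircle.equivIoc (1 : ℝ) 0 y).1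

theorem coe_circleRep (y : UnitAddCircle) : ((circleRep y : ℝ) : UnitAddCircle) = y :=
  (AddCircle.equivIoc (1 : ℝ) 0).symm_apply_apply y

theorem measurable_circleRep : Measurable circleRep :=
  measurable_subtype_coe.comp (AddCircle.measurableEquivIoc 1 0).measurable

theorem circleRep_mem (y : UnitAddCircle) : circleRep y ∈ Set.Ioc (0 : ℝ) 1 := by
  simpa only [zero_add] using! (AddCircle.equivIoc (1 : ℝ) 0 y).2

theorem circleRep_coe_of_mem {x : ℝ} (hx : x ∈ Set.Ioc (0 : ℝ) 1) :
    circleRep (x : UnitAddCircle) = x := by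
  have hx' : x ∈ Set.Ioc (0 : ℝ) (0 + 1) := by simpa using hx
  exact congrArg Subtype.val ((AddCircle.equivIoc (1 : ℝ) 0).apply_symm_apply ⟨x, hx'⟩)

theorem circleRep_coe_of_mem_int {x : ℝ} {n : ℤ} (hx : x ∈ Set.Ioc (-(n : ℝ)) (-n + 1)) :
    circleRep (x : UnitAddCircle) = x + n := by
  have h : ((x + n : ℝ) : UnitAddCircle) = (x : UnitAddCircle) := by
    rw [AddCircle.coe_add]
    simp
  rw [← h]
  exact circleRep_coe_of_mem ⟨by linarith [hx.1], by linarith [hx.2]⟩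

/-- The point `a (y - j)`, where `y` is represented in the cube `(0, 1]ᵈ`. -/
def tile {d : ℕ} (a : ℝ) (z : (Fin d → ℤ) × UnitAddTorus (Fin d)) : RSpace d :=
  WithLp.toLp 2 fun i => a * (circleRep (z.2 i) - z.1 i)

/-- The tile containing `x`, and the position of `x` in it. -/
def untile {d : ℕ} (a : ℝ) (x : RSpace d) : (Fin d → ℤ) × UnitAddTorus (Fin d) :=
  (fun i => 1 - ⌈x i / a⌉, fun i => ((x i / a : ℝ) : UnitAddCircle))

theorem measurable_tile {d : ℕ} (a : ℝ) : Measurable (tile (d := d) a) := by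
  refine (WithLp.measurable_toLp 2 _).comp (measurable_pi_lambda _ fun i => ?_)
  refine Measurable.const_mul (Measurable.sub ?_ ?_) a
  · exact measurable_circleRep.comp ((measurable_pi_apply i).comp measurable_snd)
  · exact (measurable_from_top (f := fun n : ℤ => (n : ℝ))).comp
      ((measurable_pi_apply i).comp measurable_fst)

theorem measurable_untile {d : ℕ} (a : ℝ) : Measurable (untile (d := d) a) := by
  have h (i : Fin d) : Measurable fun x : RSpace d => x i / a :=
    Measurable.div_const (by fun_prop) a
  refine Measurable.prodMk (measurable_pi_lambda _ fun i => ?_) (measurable_pi_lambda _ fun i => ?_)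
  · exact (measurable_from_top (f := fun n : ℤ => 1 - n)).comp (Int.measurable_ceil.comp (h i))
  · exact AddCircle.measurable_mk'.comp (h i)

theorem untile_tile {d : ℕ} {a : ℝ} (ha : 0 < a) (z : (Fin d → ℤ) × UnitAddTorus (Fin d)) :
    untile a (tile a z) = z := by
  have h (i : Fin d) : tile a z i / a = circleRep (z.2 i) - z.1 i := by
    simp [tile, ha.ne']
  ext i
  · simp only [untile, h]
    have := circleRep_mem (z.2 i)
    have h2 : ⌈circleRep (z.2 i) - z.1 i⌉ = 1 - z.1 i := by
      rw [Int.ceil_eq_iff]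
      push_cast
      exact ⟨by linarith [this.1], by linarith [this.2]⟩
    rw [h2]; ring
  · simp only [untile, h]
    rw [AddCircle.coe_sub, coe_circleRep]
    simp

theorem tile_untile {d : ℕ} {a : ℝ} (ha : 0 < a) (x : RSpace d) : tile a (untile a x) = x := by
  ext i
  simp only [tile, untile]
  have h1 := Int.ceil_lt_add_one (x i / a)
  have h2 := Int.le_ceil (x i / a)
  rw [circleRep_coe_of_mem_int (n := 1 - ⌈x i / a⌉)
    ⟨by push_cast; linarith, by push_cast; linarith⟩]
  field_simp
  ring

theorem tile_sub_smul_intVec {d : ℕ} (a : ℝ) (j k : Fin d → ℤ) (y : UnitAddTorus (Fin d)) :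
    tile a (j, y) - a • intVec k = tile a (j + k, y) := by
  ext i
  simp [tile, intVec]
  ring

/-- `ℝᵈ` as the product of `ℤᵈ` and the torus. -/
def tileEquiv (d : ℕ) {a : ℝ} (ha : 0 < a) :
    (Fin d → ℤ) × UnitAddTorus (Fin d) ≃ᵐ RSpace d where
  toFun := tile a
  invFun := untile a
  left_inv := untile_tile ha
  right_inv := tile_untile ha
  measurable_toFun := measurable_tile a
  measurable_invFun := measurable_untile a

/-- The half-open cubes `-j + (0, 1]ᵈ` partition the space, and on the cube of index `j` the
representative `circleRep` is translation by `j`. -/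
theorem lintegral_tile_one {d : ℕ} {u : RSpace d → ℝ≥0∞} (hu : Measurable u) :
    ∫⁻ x, u x = ∑' j : Fin d → ℤ, ∫⁻ y, u (tile 1 (j, y)) ∂torusMeasure d := by
  let box : (Fin d → ℤ) → Set (Fin d → ℝ) := fun j =>
    {x | ∀ i, x i ∈ Set.Ioc (-(j i : ℝ)) (-(j i : ℝ) + 1)}
  have hbox : ∀ j, MeasurableSet (box j) := fun j =>
    MeasurableSet.univ_pi' fun i => measurableSet_Ioc
  have hdisj : Pairwise (Function.onFun Disjoint box) := by
    intro j k hjk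
    refine Set.disjoint_left.2 fun x hj hk => hjk (funext fun i => ?_)
    have h1 : (j i : ℝ) < k i + 1 := by linarith [(hj i).2, (hk i).1]
    have h2 : (k i : ℝ) < j i + 1 := by linarith [(hj i).1, (hk i).2]
    have h1' : j i < k i + 1 := by exact_mod_cast h1
    have h2' : k i < j i + 1 := by exact_mod_cast h2
    omega
  have hcover : ⋃ j, box j = Set.univ := by
    refine Set.eq_univ_of_forall fun x => Set.mem_iUnion.2 ⟨fun i => 1 - ⌈x i⌉, fun i => ?_⟩
    have h1 := Int.ceil_lt_add_one (x i)
    have h2 := Int.le_ceil (x i)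
    exact ⟨by push_cast; linarith, by push_cast; linarith⟩
  have h0 : ∫⁻ x, u x = ∫⁻ x : Fin d → ℝ, u (WithLp.toLp 2 x) :=
    ((PiLp.volume_preserving_toLp (Fin d)).lintegral_comp hu).symm
  rw [h0, ← setLIntegral_univ, ← hcover, lintegral_iUnion hbox hdisj]
  refine tsum_congr fun j => ?_
  have h1 : ∫⁻ y, u (tile 1 (j, y)) ∂torusMeasure d =
      ∫⁻ x in box j, u (tile 1 (j, fun i => ((x i : ℝ) : UnitAddCircle))) :=
    UnitAddTorus.lintegral_preimage (fun y => u (tile 1 (j, y))) fun i => -(j i : ℝ)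
  rw [h1]
  refine setLIntegral_congr_fun (hbox j) fun x hx => ?_
  dsimp only
  congr 1
  ext i
  simp [tile, circleRep_coe_of_mem_int (hx i)]

theorem lintegral_tile {d : ℕ} {a : ℝ} (ha : 0 < a) {u : RSpace d → ℝ≥0∞} (hu : Measurable u) :
    ∫⁻ x, u x =
      ENNReal.ofReal (a ^ d) * ∑' j : Fin d → ℤ, ∫⁻ y, u (tile a (j, y)) ∂torusMeasure d := by
  have h := lintegral_tile_one (hu.comp (measurable_const_smul a))
  have h2 : ∀ j y, a • tile (d := d) 1 (j, y) = tile a (j, y) := fun j y => by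
    ext i; simp [tile]
  simp only [Function.comp_apply, h2] at h
  rw [← h, ← lintegral_map hu (measurable_const_smul a),
    Measure.map_addHaar_smul volume ha.ne', lintegral_smul_measure, smul_eq_mul, ← mul_assoc,
    finrank_euclideanSpace_fin, abs_of_nonneg (by positivity), ← ENNReal.ofReal_mul (by positivity),
    mul_inv_cancel₀ (by positivity), ENNReal.ofReal_one, one_mul]

/-- The product of the counting measure on `ℤᵈ` and the measure of the torus. -/
abbrev tileMeasure (d : ℕ) : Measure ((Fin d → ℤ) × UnitAddTorus (Fin d)) :=
  Measure.count.prod (torusMeasure d)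

theorem volume_eq_map_tile {d : ℕ} {a : ℝ} (ha : 0 < a) :
    (volume : Measure (RSpace d)) = ENNReal.ofReal (a ^ d) • (tileMeasure d).map (tile a) := by
  refine Measure.ext_of_lintegral _ fun u hu => ?_
  rw [lintegral_tile ha hu, lintegral_smul_measure, lintegral_map hu (measurable_tile a),
    lintegral_prod (fun z => u (tile a z)) (hu.comp (measurable_tile a)).aemeasurable,
    lintegral_count, smul_eq_mul]

theorem quasiMeasurePreserving_untile {d : ℕ} {a : ℝ} (ha : 0 < a) :
    Measure.QuasiMeasurePreserving (untile (d := d) a) volume (tileMeasure d) := by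
  refine ⟨measurable_untile a, ?_⟩
  rw [volume_eq_map_tile ha, Measure.map_smul, Measure.map_map (measurable_untile a)
    (measurable_tile a), show untile a ∘ tile a = id from funext (untile_tile ha), Measure.map_id]
  exact Measure.smul_absolutelyContinuous

theorem quasiMeasurePreserving_tile {d : ℕ} {a : ℝ} (ha : 0 < a) :
    Measure.QuasiMeasurePreserving (tile (d := d) a) (tileMeasure d) volume := by
  refine ⟨measurable_tile a, ?_⟩
  rw [volume_eq_map_tile ha]
  exact Measure.absolutelyContinuous_smul (by simp [pow_pos ha])

/-- Every point has positive counting measure, and there are countably many `j`. -/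
theorem ae_tileMeasure_iff {d : ℕ} {P : (Fin d → ℤ) × UnitAddTorus (Fin d) → Prop} :
    (∀ᵐ z ∂tileMeasure d, P z) ↔ ∀ j, ∀ᵐ y ∂torusMeasure d, P (j, y) := by
  constructor
  · intro h j
    exact Measure.ae_count_iff.1 (Measure.ae_ae_of_ae_prod h) j
  · intro h
    filter_upwards [ae_all_iff.2 fun j => Measure.quasiMeasurePreserving_snd.ae (h j)] with z hz
      using hz z.1

theorem ae_tile {d : ℕ} {a : ℝ} (ha : 0 < a) {P : RSpace d → Prop} (h : ∀ᵐ x, P x)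
    (j : Fin d → ℤ) : ∀ᵐ y ∂torusMeasure d, P (tile a (j, y)) :=
  ae_tileMeasure_iff.1 ((quasiMeasurePreserving_tile ha).ae h) j

theorem integral_tile {d : ℕ} {a : ℝ} (ha : 0 < a) {u : RSpace d → ℂ} (hu : Integrable u) :
    Integrable (fun y => ∑' j : Fin d → ℤ, u (tile a (j, y))) (torusMeasure d) ∧
      ∫ x, u x = ((a ^ d : ℝ) : ℂ) * ∫ y, ∑' j : Fin d → ℤ, u (tile a (j, y)) ∂torusMeasure d := by
  have hc : ENNReal.ofReal (a ^ d) ≠ 0 := by simp [pow_pos ha]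
  have hv : Integrable (fun z => u (tile a z)) (tileMeasure d) := by
    rw [volume_eq_map_tile ha, integrable_smul_measure hc ENNReal.ofReal_ne_top] at hu
    exact (integrable_map_equiv (tileEquiv d ha) u).1 hu
  have hsum : (fun y => ∫ j, u (tile a (j, y)) ∂Measure.count) =ᵐ[torusMeasure d]
      fun y => ∑' j : Fin d → ℤ, u (tile a (j, y)) := by
    filter_upwards [hv.prod_left_ae] with y hy
    rw [integral_countable hy]
    simp [Measure.real]
  refine ⟨hv.integral_prod_right.congr hsum, ?_⟩
  rw [← integral_congr_ae hsum, ← integral_prod_symm _ hv]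
  conv_lhs => rw [volume_eq_map_tile ha]
  rw [integral_smul_measure, ENNReal.toReal_ofReal (by positivity)]
  rw [show ∫ x, u x ∂(tileMeasure d).map (tile a) = ∫ z, u (tile a z) ∂tileMeasure d from
    integral_map_equiv (tileEquiv d ha) u, Complex.real_smul]

open UnitAddTorus

/-! ### Fourier coefficients of integrable functions on the torus -/

theorem mFourierCoeff_eq_integral_mul {d : ℕ} (H : UnitAddTorus (Fin d) → ℂ) (k : Fin d → ℤ) :
    mFourierCoeff H k = ∫ θ, mFourier (-k) θ * H θ ∂torusMeasure d := rfl

theorem mFourierCoeff_congr_ae {d : ℕ} {F H : UnitAddTorus (Fin d) → ℂ}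
    (h : F =ᵐ[torusMeasure d] H) (k : Fin d → ℤ) : mFourierCoeff F k = mFourierCoeff H k :=
  integral_congr_ae (by filter_upwards [h] with θ hθ using by rw [hθ])

theorem norm_mFourier_apply {d : ℕ} (k : Fin d → ℤ) (θ : UnitAddTorus (Fin d)) :
    ‖mFourier k θ‖ = 1 := by
  simp only [mFourier, ContinuousMap.coe_mk, fourier_apply, norm_prod, Circle.norm_coe,
    Finset.prod_const_one]

theorem _root_.ContinuousMap.integrable_mul {d : ℕ} (φ : C(UnitAddTorus (Fin d), ℂ))
    {H : UnitAddTorus (Fin d) → ℂ} (hH : Integrable H (torusMeasure d)) :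
    Integrable (fun θ => φ θ * H θ) (torusMeasure d) :=
  hH.bdd_mul φ.continuous.aestronglyMeasurable (c := ‖φ‖)
    (Eventually.of_forall φ.norm_coe_le_norm)

/-- Integration against `H` is a bounded functional on continuous functions that vanishes on the
characters, whose span is dense. -/
theorem integral_continuousMap_mul_eq_zero {d : ℕ} {H : UnitAddTorus (Fin d) → ℂ}
    (hH : Integrable H (torusMeasure d)) (h : ∀ k, mFourierCoeff H k = 0)
    (φ : C(UnitAddTorus (Fin d), ℂ)) : ∫ θ, φ θ * H θ ∂torusMeasure d = 0 := by
  let L₀ : C(UnitAddTorus (Fin d), ℂ) →ₗ[ℂ] ℂ :=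
    { toFun := fun φ => ∫ θ, φ θ * H θ ∂torusMeasure d
      map_add' := fun φ ψ => by
        simp only [ContinuousMap.add_apply, add_mul]
        exact integral_add (φ.integrable_mul hH) (ψ.integrable_mul hH)
      map_smul' := fun c φ => by
        simp only [ContinuousMap.smul_apply, smul_eq_mul, mul_assoc, RingHom.id_apply]
        exact integral_const_mul _ _ }
  let L : C(UnitAddTorus (Fin d), ℂ) →L[ℂ] ℂ :=
    L₀.mkContinuous (∫ θ, ‖H θ‖ ∂torusMeasure d) fun φ => by
      refine (norm_integral_le_of_norm_le (hH.norm.mul_const ‖φ‖)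
        (Eventually.of_forall fun θ => ?_)).trans_eq (integral_mul_const _ _)
      rw [norm_mul, mul_comm]
      exact mul_le_mul_of_nonneg_left (φ.norm_coe_le_norm θ) (norm_nonneg _)
  have hspan : Submodule.span ℂ (Set.range (mFourier (d := Fin d))) ≤ L.ker := by
    rw [Submodule.span_le]
    rintro _ ⟨k, rfl⟩
    have := h (-k)
    rw [mFourierCoeff_eq_integral_mul, neg_neg] at this
    exact this
  have htop := Submodule.topologicalClosure_minimal _ hspan L.isClosed_ker
  rw [span_mFourier_closure_eq_top] at htop
  exact htop (Submodule.mem_top (x := φ))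

/-- Indicators of closed sets are bounded pointwise limits of continuous functions, so by dominated
convergence the integral of `H` over every closed set vanishes. -/
theorem ae_eq_zero_of_mFourierCoeff_eq_zero {d : ℕ} {H : UnitAddTorus (Fin d) → ℂ}
    (hH : Integrable H (torusMeasure d)) (h : ∀ k, mFourierCoeff H k = 0) :
    H =ᵐ[torusMeasure d] 0 := by
  refine ae_eq_zero_of_forall_setIntegral_isClosed_eq_zero hH fun s hs => ?_
  let φ : ℕ → C(UnitAddTorus (Fin d), ℂ) := fun n =>
    ⟨fun θ => ((hs.apprSeq n θ : ℝ) : ℂ), by fun_prop⟩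
  have hlim : Tendsto (fun n => ∫ θ, φ n θ * H θ ∂torusMeasure d) atTop
      (𝓝 (∫ θ, s.indicator H θ ∂torusMeasure d)) := by
    refine tendsto_integral_of_dominated_convergence (fun θ => ‖H θ‖)
      (fun n => ((φ n).integrable_mul hH).1) hH.norm (fun n => Eventually.of_forall fun θ => ?_)
      (Eventually.of_forall fun θ => ?_)
    · have : ‖φ n θ‖ ≤ 1 := by
        have := HasOuterApproxClosed.apprSeq_apply_le_one hs n θ
        simpa [φ] using this
      rw [norm_mul]
      exact mul_le_of_le_one_left (norm_nonneg _) this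
    · have h1 := tendsto_pi_nhds.1 (HasOuterApproxClosed.tendsto_apprSeq hs) θ
      have h2 : Tendsto (fun n => φ n θ) atTop
          (𝓝 (((s.indicator (fun _ => (1 : NNReal)) θ : NNReal) : ℝ) : ℂ)) :=
        (Complex.continuous_ofReal.tendsto _).comp ((NNReal.continuous_coe.tendsto _).comp h1)
      have h3 := h2.mul_const (H θ)
      convert h3 using 2
      by_cases hθ : θ ∈ s <;> simp [hθ]
  rw [← integral_indicator hs.measurableSet]
  refine tendsto_nhds_unique hlim ?_
  simp only [integral_continuousMap_mul_eq_zero hH h]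
  exact tendsto_const_nhds

theorem ae_eq_of_mFourierCoeff_eq {d : ℕ} {F H : UnitAddTorus (Fin d) → ℂ}
    (hF : Integrable F (torusMeasure d)) (hH : Integrable H (torusMeasure d))
    (h : ∀ k, mFourierCoeff F k = mFourierCoeff H k) : F =ᵐ[torusMeasure d] H := by
  refine (sub_ae_eq_zero _ _).1 (ae_eq_zero_of_mFourierCoeff_eq_zero (hF.sub hH) fun k => ?_)
  rw [mFourierCoeff_eq_integral_mul]
  simp only [Pi.sub_apply, mul_sub]
  rw [integral_sub ((mFourier (-k)).integrable_mul hF) ((mFourier (-k)).integrable_mul hH),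
    ← mFourierCoeff_eq_integral_mul, ← mFourierCoeff_eq_integral_mul, h, sub_self]

theorem tsum_enorm_sq_mFourierCoeff_Lp {d : ℕ} (u : Lp ℂ 2 (torusMeasure d)) :
    ∑' k, ‖mFourierCoeff u k‖ₑ ^ 2 = ∫⁻ θ, ‖u θ‖ₑ ^ 2 ∂torusMeasure d := by
  have h : HasSum (fun k => ‖mFourierCoeff u k‖ ^ 2) (∫ θ, ‖u θ‖ ^ 2 ∂torusMeasure d) :=
    hasSum_sq_mFourierCoeff u
  have hint : Integrable (fun θ => ‖u θ‖ ^ 2) (torusMeasure d) :=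
    (memLp_two_iff_integrable_sq_norm (Lp.aestronglyMeasurable u)).1 (Lp.memLp u)
  have he : ∀ z : ℂ, ‖z‖ₑ ^ 2 = ENNReal.ofReal (‖z‖ ^ 2) := fun z => by
    rw [ENNReal.ofReal_pow (norm_nonneg _), ofReal_norm]
  simp only [he]
  rw [← ENNReal.ofReal_tsum_of_nonneg (fun _ => by positivity) h.summable, h.tsum_eq,
    ofReal_integral_eq_lintegral_ofReal hint (Eventually.of_forall fun _ => by positivity)]

theorem memLp_two_of_lintegral_enorm_sq_ne_top {X : Type*} [MeasurableSpace X] {μ : Measure X}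
    {H : X → ℂ} (hH : AEStronglyMeasurable H μ) (h : ∫⁻ x, ‖H x‖ₑ ^ 2 ∂μ ≠ ∞) :
    MemLp H 2 μ := by
  refine ⟨hH, (eLpNorm_lt_top_iff_lintegral_rpow_enorm_lt_top (by norm_num) (by norm_num)).2 ?_⟩
  simpa [lt_top_iff_ne_top] using h

/-- Riesz–Fischer. The `HasSum` clause is what identifies the series defining `zakFiber`. -/
theorem exists_Lp_mFourierCoeff_eq {d : ℕ} {c : (Fin d → ℤ) → ℂ} (hc : ∑' k, ‖c k‖ₑ ^ 2 ≠ ∞) :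
    ∃ u : Lp ℂ 2 (torusMeasure d), (∀ k, mFourierCoeff u k = c k) ∧
      HasSum (fun k => c k • torusExp k) u := by
  have hmem : Memℓp c 2 := by
    rw [memℓp_gen_iff (by norm_num)]
    have : ∑' k, ((‖c k‖₊ ^ 2 : NNReal) : ℝ≥0∞) ≠ ∞ := by simpa [enorm_eq_nnnorm] using hc
    have := ENNReal.tsum_coe_ne_top_iff_summable.1 this
    have := NNReal.summable_coe.2 this
    simpa using this
  let w : lp (fun _ : Fin d → ℤ => ℂ) 2 := ⟨c, hmem⟩
  let u : Lp ℂ 2 (torusMeasure d) := (mFourierBasis (d := Fin d)).repr.symm w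
  have hu : ∀ k, mFourierCoeff u k = c k := fun k => by
    have h1 := mFourierBasis_repr (d := Fin d) u k
    rw [← h1]
    change ((mFourierBasis (d := Fin d)).repr ((mFourierBasis (d := Fin d)).repr.symm w)) k = c k
    rw [LinearIsometryEquiv.apply_symm_apply]
  refine ⟨u, hu, ?_⟩
  have := hasSum_mFourier_series_L2 (d := Fin d) u
  simp only [hu] at this
  exact this

/-- Parseval's identity for integrable functions, as an identity in `[0, ∞]`. -/
theorem tsum_enorm_sq_mFourierCoeff {d : ℕ} {H : UnitAddTorus (Fin d) → ℂ}
    (hH : Integrable H (torusMeasure d)) :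
    ∑' k, ‖mFourierCoeff H k‖ₑ ^ 2 = ∫⁻ θ, ‖H θ‖ₑ ^ 2 ∂torusMeasure d := by
  have key : ∀ u : Lp ℂ 2 (torusMeasure d), H =ᵐ[torusMeasure d] u →
      ∑' k, ‖mFourierCoeff H k‖ₑ ^ 2 = ∫⁻ θ, ‖H θ‖ₑ ^ 2 ∂torusMeasure d := fun u hu => by
    rw [lintegral_congr_ae (by filter_upwards [hu] with θ hθ using by rw [hθ]),
      ← tsum_enorm_sq_mFourierCoeff_Lp u]
    exact tsum_congr fun k => by rw [mFourierCoeff_congr_ae hu]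
  by_cases hfin : ∫⁻ θ, ‖H θ‖ₑ ^ 2 ∂torusMeasure d = ∞
  · by_cases hsum : ∑' k, ‖mFourierCoeff H k‖ₑ ^ 2 = ∞
    · rw [hfin, hsum]
    -- Square summable coefficients come from an `L²` function, which must be `H` because
    -- coefficients determine integrable functions.
    obtain ⟨u, hu, -⟩ := exists_Lp_mFourierCoeff_eq hsum
    have hui : Integrable u (torusMeasure d) := (Lp.memLp u).integrable (by norm_num)
    exact key u (ae_eq_of_mFourierCoeff_eq hH hui fun k => (hu k).symm)
  · have hm := memLp_two_of_lintegral_enorm_sq_ne_top hH.1 hfin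
    exact key (hm.toLp H) hm.coeFn_toLp.symm

/-- Multiplying `w` by the character of index `-n` shifts its coefficients by `n`; then apply the
polarised Parseval identity. -/
theorem tsum_conj_mFourierCoeff_mul {d : ℕ} (u w : Lp ℂ 2 (torusMeasure d)) (n : Fin d → ℤ) :
    ∑' j, (starRingEnd ℂ) (mFourierCoeff u j) * mFourierCoeff w (j + n) =
      mFourierCoeff (fun θ => (starRingEnd ℂ) (u θ) * w θ) n := by
  have hm : MemLp (fun θ => mFourier (-n) θ * w θ) 2 (torusMeasure d) := by
    refine (Lp.memLp w).of_le
      ((mFourier (-n)).continuous.aestronglyMeasurable.mul (Lp.aestronglyMeasurable w))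
      (Eventually.of_forall fun θ => ?_)
    rw [norm_mul, norm_mFourier_apply, one_mul]
  have h := (hasSum_prod_mFourierCoeff (d := Fin d) u (hm.toLp _)).tsum_eq
  have hc : ∀ j, mFourierCoeff (hm.toLp _) j = mFourierCoeff w (j + n) := fun j => by
    rw [mFourierCoeff_congr_ae hm.coeFn_toLp]
    simp only [mFourierCoeff_eq_integral_mul]
    refine integral_congr_ae (Eventually.of_forall fun θ => ?_)
    simp only [← mul_assoc, ← mFourier_add, neg_add]
  simp only [hc] at h
  rw [h, mFourierCoeff_eq_integral_mul]
  refine integral_congr_ae ?_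
  filter_upwards [hm.coeFn_toLp] with θ hθ
  rw [hθ]
  ring

/-! ### Averages over the points of order `p` of the torus -/

/-- The point `s / p` of the torus. -/
def torusFrac {d p : ℕ} (s : Fin d → Fin p) : UnitAddTorus (Fin d) :=
  fun i => ((((s i : ℕ) : ℝ) / p : ℝ) : UnitAddCircle)

/-- Addition in `Fin p` discards a multiple of `p`, which after division by `p` is an integer and
vanishes in the circle. Sums over `s` are therefore invariant under translation by points of order
`p`. -/
theorem torusFrac_add {d p : ℕ} [NeZero p] (s t : Fin d → Fin p) :
    torusFrac (s + t) = torusFrac s + torusFrac t := by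
  funext i
  have hp : (p : ℝ) ≠ 0 := NeZero.ne _
  simp only [torusFrac, Pi.add_apply, Fin.val_add, ← AddCircle.coe_add]
  have h : (((s i : ℕ) : ℝ) / p + ((t i : ℕ) : ℝ) / p) =
      ((((s i : ℕ) + (t i : ℕ)) % p : ℕ) : ℝ) / p + ((((s i : ℕ) + (t i : ℕ)) / p : ℕ) : ℝ) := by
    have := Nat.mod_add_div ((s i : ℕ) + (t i : ℕ)) p
    have h2 : ((((s i : ℕ) + (t i : ℕ)) % p : ℕ) : ℝ) + p * ((((s i : ℕ) + (t i : ℕ)) / p : ℕ) : ℝ)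
        = (s i : ℕ) + (t i : ℕ) := by exact_mod_cast this
    field_simp
    linarith
  rw [h, AddCircle.coe_add, show ((((((s i : ℕ) + (t i : ℕ)) / p : ℕ) : ℝ)) : UnitAddCircle) = 0 from
    (AddCircle.coe_eq_zero_iff (1 : ℝ)).2 ⟨((((s i : ℕ) + (t i : ℕ)) / p : ℕ) : ℤ), by
      rw [zsmul_eq_mul, mul_one, Int.cast_natCast]⟩, add_zero]

theorem torusFrac_injective {d p : ℕ} [NeZero p] :
    Function.Injective (torusFrac : (Fin d → Fin p) → UnitAddTorus (Fin d)) := by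
  intro s t h
  funext i
  have hp : (0 : ℝ) < p := Nat.cast_pos.2 (NeZero.pos p)
  have hmem : ∀ u : Fin p, ((u : ℕ) : ℝ) / p ∈ Set.Ico (0 : ℝ) (0 + 1) := fun u => by
    refine ⟨by positivity, ?_⟩
    rw [zero_add, div_lt_one hp]
    exact_mod_cast u.2
  have h1 := (AddCircle.coe_eq_coe_iff_of_mem_Ico (hmem (s i)) (hmem (t i))).1 (congrFun h i)
  rw [div_left_inj' hp.ne'] at h1
  exact Fin.ext (by exact_mod_cast h1)

theorem mFourier_apply_add {d : ℕ} (k : Fin d → ℤ) (θ η : UnitAddTorus (Fin d)) :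
    mFourier k (θ + η) = mFourier k θ * mFourier k η := by
  simp only [mFourier, ContinuousMap.coe_mk, Pi.add_apply, fourier_apply, smul_add,
    AddCircle.toCircle_add, Circle.coe_mul, Finset.prod_mul_distrib]

theorem mFourierCoeff_comp_add {d : ℕ} (H : UnitAddTorus (Fin d) → ℂ)
    (η : UnitAddTorus (Fin d)) (k : Fin d → ℤ) :
    mFourierCoeff (fun θ => H (θ + η)) k = mFourier k η * mFourierCoeff H k := by
  simp only [mFourierCoeff_eq_integral_mul]
  rw [← integral_add_right_eq_self (fun θ => mFourier (-k) θ * H θ) η, ← integral_const_mul]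
  refine integral_congr_ae (Eventually.of_forall fun θ => ?_)
  have h : mFourier k η * mFourier (-k) η = 1 := by
    rw [← mFourier_add, add_neg_cancel, mFourier_zero]; rfl
  simp only [mFourier_apply_add]
  linear_combination (-(mFourier (-k) θ * H (θ + η))) * h

theorem fourier_frac {p : ℕ} (k : ℤ) (n : ℕ) :
    fourier k (((n : ℝ) / p : ℝ) : UnitAddCircle) =
      Complex.exp (2 * Real.pi * Complex.I * (k * n / p)) := by
  rw [fourier_coe_apply]
  congr 1
  push_cast
  ring

theorem mFourier_smul_torusFrac {d p : ℕ} [NeZero p] (m : Fin d → ℤ) (s : Fin d → Fin p) :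
    mFourier (fun i => (p : ℤ) * m i) (torusFrac s) = 1 := by
  have hp : (p : ℂ) ≠ 0 := NeZero.ne _
  simp only [mFourier, ContinuousMap.coe_mk]
  refine Finset.prod_eq_one fun i _ => ?_
  rw [torusFrac, fourier_frac, Complex.exp_eq_one_iff]
  refine ⟨m i * (s i : ℕ), ?_⟩
  push_cast
  field_simp

theorem exists_mFourier_torusFrac_ne_one {d p : ℕ} [NeZero p] {k : Fin d → ℤ}
    (hk : k ∉ Set.range fun (m : Fin d → ℤ) i => (p : ℤ) * m i) :
    ∃ s : Fin d → Fin p, mFourier k (torusFrac s) ≠ 1 := by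
  have hp : (p : ℂ) ≠ 0 := NeZero.ne _
  obtain ⟨i, hi⟩ : ∃ i, ¬ (p : ℤ) ∣ k i := by
    by_contra! h
    choose m hm using h
    exact hk ⟨m, funext fun i => (hm i).symm⟩
  -- For `p = 1` the element `1 : Fin p` is zero, but then `p` divides every `k i`.
  have hp1 : 1 < p := by
    have := NeZero.pos p
    by_contra h
    exact hi ((show p = 1 by omega) ▸ by simp)
  have h1 : (((1 : Fin p) : ℕ)) = 1 := by
    rw [Fin.val_one', Nat.mod_eq_of_lt hp1]
  refine ⟨Pi.single i 1, fun h => hi ?_⟩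
  have h2 : mFourier k (torusFrac (Pi.single i (1 : Fin p))) =
      fourier (k i) (((1 : ℕ) / p : ℝ) : UnitAddCircle) := by
    simp only [mFourier, ContinuousMap.coe_mk]
    rw [Finset.prod_eq_single i]
    · simp only [torusFrac, Pi.single_eq_same, h1]
    · intro j _ hj
      simp [torusFrac, hj]
    · simp
  rw [h2, fourier_frac, Complex.exp_eq_one_iff] at h
  obtain ⟨n, hn⟩ := h
  refine ⟨n, ?_⟩
  have hpi : (2 * Real.pi * Complex.I : ℂ) ≠ 0 := by simp [Real.pi_ne_zero]
  have h3 : (k i : ℂ) = p * n := by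
    have : (k i * (1 : ℕ) / p : ℂ) = n := mul_left_cancel₀ hpi (hn.trans (mul_comm _ _))
    rw [← this]
    field_simp
    simp
  exact_mod_cast h3

theorem integrable_comp_add {d : ℕ} {H : UnitAddTorus (Fin d) → ℂ}
    (hH : Integrable H (torusMeasure d)) (η : UnitAddTorus (Fin d)) :
    Integrable (fun θ => H (θ + η)) (torusMeasure d) :=
  hH.comp_add_right η

/-- The Fourier coefficients with index in `pℤᵈ` of an integrable function. -/
theorem tsum_enorm_sq_mFourierCoeff_smul {d p : ℕ} [NeZero p] {H : UnitAddTorus (Fin d) → ℂ}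
    (hH : Integrable H (torusMeasure d)) :
    ENNReal.ofReal ((p : ℝ) ^ d) ^ 2 *
        ∑' m : Fin d → ℤ, ‖mFourierCoeff H (fun i => (p : ℤ) * m i)‖ₑ ^ 2 =
      ∫⁻ θ, ‖∑ s : Fin d → Fin p, H (θ + torusFrac s)‖ₑ ^ 2 ∂torusMeasure d := by
  have hint : ∀ s : Fin d → Fin p, Integrable (fun θ => H (θ + torusFrac s)) (torusMeasure d) :=
    fun s => integrable_comp_add hH _
  have hK : Integrable (fun θ => ∑ s : Fin d → Fin p, H (θ + torusFrac s)) (torusMeasure d) :=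
    integrable_finsetSum _ fun s _ => hint s
  -- The character sum in front equals `p^d` when `k` lies in `pℤᵈ`.
  have hcoeff : ∀ k, mFourierCoeff (fun θ => ∑ s : Fin d → Fin p, H (θ + torusFrac s)) k =
      (∑ s : Fin d → Fin p, mFourier k (torusFrac s)) * mFourierCoeff H k := fun k => by
    simp only [Finset.sum_mul, ← mFourierCoeff_comp_add]
    simp only [mFourierCoeff_eq_integral_mul, Finset.mul_sum]
    exact integral_finsetSum _ fun s _ => (mFourier (-k)).integrable_mul (hint s)
  have hinv : ∀ (t : Fin d → Fin p) θ,
      ∑ s : Fin d → Fin p, H (θ + torusFrac t + torusFrac s) =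
        ∑ s : Fin d → Fin p, H (θ + torusFrac s) := fun t θ => by
    simp only [add_assoc, ← torusFrac_add]
    exact Equiv.sum_comp (Equiv.addLeft t) fun s => H (θ + torusFrac s)
  -- The summed function is invariant under translation by `t/p`, which multiplies its coefficient
  -- of index `k` by a number other than `1`.
  have hzero : ∀ k, k ∉ Set.range (fun (m : Fin d → ℤ) i => (p : ℤ) * m i) →
      mFourierCoeff (fun θ => ∑ s : Fin d → Fin p, H (θ + torusFrac s)) k = 0 := fun k hk => by
    obtain ⟨t, ht⟩ := exists_mFourier_torusFrac_ne_one hk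
    have h := mFourierCoeff_comp_add
      (fun θ => ∑ s : Fin d → Fin p, H (θ + torusFrac s)) (torusFrac t) k
    simp only [hinv] at h
    by_contra h0
    exact ht (mul_right_cancel₀ h0 (by rw [← h, one_mul]))
  have hinj : Function.Injective fun (m : Fin d → ℤ) i => (p : ℤ) * m i := fun m n h =>
    funext fun i => mul_left_cancel₀ (by exact_mod_cast NeZero.ne p) (congrFun h i)
  rw [← tsum_enorm_sq_mFourierCoeff hK, ← hinj.tsum_eq (f := fun k => ‖mFourierCoeff
    (fun θ => ∑ s : Fin d → Fin p, H (θ + torusFrac s)) k‖ₑ ^ 2), ← ENNReal.tsum_mul_left]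
  · refine tsum_congr fun m => ?_
    rw [hcoeff, enorm_mul, mul_pow]
    simp only [mFourier_smul_torusFrac]
    congr 2
    rw [← ofReal_norm]
    simp
  · intro k hk
    by_contra h
    exact hk (by simp [hzero k h])

/-! ### Fourier coefficients of the Zak transform -/

theorem lintegral_enorm_sq_Lp {X : Type*} [MeasurableSpace X] {μ : Measure X} (f : Lp ℂ 2 μ) :
    ∫⁻ x, ‖f x‖ₑ ^ 2 ∂μ = ‖f‖ₑ ^ 2 := by
  have h := eLpNorm_nnreal_pow_eq_lintegral (f := f) (μ := μ) (p := 2) (by norm_num)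
  rw [Lp.enorm_def]
  simpa using h.symm

theorem measurable_Lp {X : Type*} [MeasurableSpace X] {μ : Measure X} (f : Lp ℂ 2 μ) :
    Measurable f :=
  (Lp.stronglyMeasurable f).measurable

/-- The coefficients `f (x - a k)` are square summable. -/
def ZakSummable {d : ℕ} (a : ℝ) (f : L2 d) (x : RSpace d) : Prop :=
  ∑' k : Fin d → ℤ, ‖f (x - a • intVec k)‖ₑ ^ 2 ≠ ∞

/-- Summing `|f|²` over all tiles and integrating over `y` gives a multiple of `‖f‖²`, so the sum is
finite for almost every `y`. The sum depends on `x` only through its position `y` in its tile. -/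
theorem ae_zakSummable {d : ℕ} {a : ℝ} (ha : 0 < a) (f : L2 d) : ∀ᵐ x, ZakSummable a f x := by
  have hmeas : Measurable fun x => ‖f x‖ₑ ^ 2 := (measurable_Lp f).enorm.pow_const 2
  have hj : ∀ j : Fin d → ℤ, Measurable fun y => ‖f (tile a (j, y))‖ₑ ^ 2 := fun j =>
    hmeas.comp ((measurable_tile a).comp measurable_prodMk_left)
  have h := lintegral_tile ha hmeas
  rw [lintegral_enorm_sq_Lp, ← lintegral_tsum fun j => (hj j).aemeasurable] at h
  have hfin : ∫⁻ y, ∑' j : Fin d → ℤ, ‖f (tile a (j, y))‖ₑ ^ 2 ∂torusMeasure d ≠ ∞ := by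
    intro htop
    rw [htop, ENNReal.mul_top (by simp [pow_pos ha])] at h
    simp at h
  have hae := ae_lt_top (Measurable.tsum hj) hfin
  have hz : ∀ᵐ z ∂tileMeasure d, ∑' j : Fin d → ℤ, ‖f (tile a (j, z.2))‖ₑ ^ 2 < ∞ :=
    ae_tileMeasure_iff.2 fun _ => hae
  filter_upwards [(quasiMeasurePreserving_untile ha).ae hz] with x hx
  have hk : ∀ k, x - a • intVec k = tile a ((untile a x).1 + k, (untile a x).2) := fun k => by
    rw [← tile_sub_smul_intVec, Prod.mk.eta, tile_untile ha]
  simp only [ZakSummable, hk]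
  rw [← (Equiv.addLeft (untile a x).1).tsum_eq] at hx
  exact hx.ne

theorem mFourierCoeff_zakFiber {d : ℕ} {a : ℝ} {f : L2 d} {x : RSpace d} (h : ZakSummable a f x)
    (k : Fin d → ℤ) : mFourierCoeff (zakFiber a f x) k = f (x - a • intVec k) := by
  obtain ⟨u, hu, hsum⟩ := exists_Lp_mFourierCoeff_eq h
  rw [← hu k, zakFiber, hsum.tsum_eq]

theorem lintegral_enorm_sq_zakTorus {d : ℕ} {a : ℝ} {f : L2 d} {x : RSpace d}
    (h : ZakSummable a f x) :
    ∫⁻ θ, ‖zakTorus a f (x, θ)‖ₑ ^ 2 ∂torusMeasure d =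
      ∑' k : Fin d → ℤ, ‖f (x - a • intVec k)‖ₑ ^ 2 := by
  simp only [← mFourierCoeff_zakFiber h]
  rw [tsum_enorm_sq_mFourierCoeff_Lp]
  refine lintegral_congr_ae ?_
  filter_upwards [zakTorus_ae_eq a f x] with θ hθ
  rw [hθ]

theorem memLp_zakTorus {d : ℕ} (a : ℝ) (f : L2 d) (x : RSpace d) :
    MemLp (fun θ => zakTorus a f (x, θ)) 2 (torusMeasure d) :=
  (memLp_congr_ae (zakTorus_ae_eq a f x)).2 (Lp.memLp _)

theorem integrable_conj_zakTorus_mul {d : ℕ} (a : ℝ) (f g : L2 d) (x x' : RSpace d) :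
    Integrable (fun θ => (starRingEnd ℂ) (zakTorus a f (x, θ)) * zakTorus a g (x', θ))
      (torusMeasure d) :=
  (memLp_zakTorus a f x).star.integrable_mul (memLp_zakTorus a g x')

/-- The samples are the Fourier coefficients of the Zak transforms, so correlating samples amounts
to multiplying Zak transforms. -/
theorem tsum_conj_mul_eq_mFourierCoeff {d : ℕ} {a : ℝ} {f g : L2 d} {x x' : RSpace d}
    (hf : ZakSummable a f x) (hg : ZakSummable a g x') (n : Fin d → ℤ) :
    ∑' j, (starRingEnd ℂ) (f (x - a • intVec j)) * g (x' - a • intVec (j + n)) =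
      mFourierCoeff
        (fun θ => (starRingEnd ℂ) (zakTorus a f (x, θ)) * zakTorus a g (x', θ)) n := by
  simp only [← mFourierCoeff_zakFiber hf, ← mFourierCoeff_zakFiber hg]
  rw [tsum_conj_mFourierCoeff_mul]
  refine mFourierCoeff_congr_ae ?_ n
  filter_upwards [zakTorus_ae_eq a f x, zakTorus_ae_eq a g x'] with θ h1 h2
  rw [h1, h2]

/-! ### The Zak transform over a tile -/

/-- The Zak transform at the point `v + tile a (c, y)`, as a function of two torus variables. -/
def zakTile {d : ℕ} (a : ℝ) (f : L2 d) (c : Fin d → ℤ) (v : RSpace d)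
    (z : UnitAddTorus (Fin d) × UnitAddTorus (Fin d)) : ℂ :=
  zakTorus a f (tile a (c, z.1) + v, z.2)

theorem measurable_zakTile {d : ℕ} (a : ℝ) (f : L2 d) (c : Fin d → ℤ) (v : RSpace d) :
    Measurable (zakTile a f c v) :=
  (stronglyMeasurable_zakTorus a f).measurable.comp
    ((((measurable_tile a).comp (measurable_const.prodMk measurable_fst)).add_const v).prodMk
      measurable_snd)

theorem measurable_comp_torusFrac {d p : ℕ} {W : UnitAddTorus (Fin d) × UnitAddTorus (Fin d) → ℂ}
    (hW : Measurable W) (s : Fin d → Fin p) :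
    Measurable fun z : UnitAddTorus (Fin d) × UnitAddTorus (Fin d) =>
      W (z.1, z.2 + torusFrac s) :=
  hW.comp (measurable_fst.prodMk (measurable_snd.add_const _))

/-- The sum of `|W|²` over the translates of the second variable by points of order `p`. -/
def shiftSq {d : ℕ} (p : ℕ) (W : UnitAddTorus (Fin d) × UnitAddTorus (Fin d) → ℂ)
    (z : UnitAddTorus (Fin d) × UnitAddTorus (Fin d)) : ℝ≥0∞ :=
  ∑ s : Fin d → Fin p, ‖W (z.1, z.2 + torusFrac s)‖ₑ ^ 2

/-- The squared norm of the products of the matrix `G` and the conjugate of `W`, both translated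
by the points of order `p` in the second variable. -/
def shiftMix {d q : ℕ} (p : ℕ)
    (G : (Fin d → Fin q) → UnitAddTorus (Fin d) × UnitAddTorus (Fin d) → ℂ)
    (W : UnitAddTorus (Fin d) × UnitAddTorus (Fin d) → ℂ)
    (z : UnitAddTorus (Fin d) × UnitAddTorus (Fin d)) : ℝ≥0∞ :=
  ∑ r : Fin d → Fin q, ‖∑ s : Fin d → Fin p,
    (starRingEnd ℂ) (W (z.1, z.2 + torusFrac s)) * G r (z.1, z.2 + torusFrac s)‖ₑ ^ 2

theorem measurable_shiftSq {d p : ℕ} {W : UnitAddTorus (Fin d) × UnitAddTorus (Fin d) → ℂ}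
    (hW : Measurable W) : Measurable (shiftSq p W) :=
  Finset.measurable_fun_sum _ fun s _ => (measurable_comp_torusFrac hW s).enorm.pow_const 2

theorem measurable_shiftMix_term {d p : ℕ}
    {G W : UnitAddTorus (Fin d) × UnitAddTorus (Fin d) → ℂ}
    (hG : Measurable G) (hW : Measurable W) :
    Measurable fun z : UnitAddTorus (Fin d) × UnitAddTorus (Fin d) =>
      ‖∑ s : Fin d → Fin p, (starRingEnd ℂ) (W (z.1, z.2 + torusFrac s)) *
        G (z.1, z.2 + torusFrac s)‖ₑ ^ 2 :=
  (Finset.measurable_fun_sum _ fun s _ => (Complex.continuous_conj.measurable.comp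
    (measurable_comp_torusFrac hW s)).mul (measurable_comp_torusFrac hG s)).enorm.pow_const 2

theorem measurable_shiftMix {d p q : ℕ}
    {G : (Fin d → Fin q) → UnitAddTorus (Fin d) × UnitAddTorus (Fin d) → ℂ}
    {W : UnitAddTorus (Fin d) × UnitAddTorus (Fin d) → ℂ}
    (hG : ∀ r, Measurable (G r)) (hW : Measurable W) : Measurable (shiftMix p G W) :=
  Finset.measurable_fun_sum _ fun r _ => measurable_shiftMix_term (hG r) hW

theorem ae_zakSummable_tile {d : ℕ} {a : ℝ} (ha : 0 < a) (f : L2 d) (c : Fin d → ℤ)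
    (v : RSpace d) : ∀ᵐ y ∂torusMeasure d, ZakSummable a f (tile a (c, y) + v) :=
  ae_tile ha ((measurePreserving_add_right volume v).quasiMeasurePreserving.ae
    (ae_zakSummable ha f)) c

/-- The squared norm of `f` as an integral of its Zak transform over a tile. -/
theorem enorm_sq_eq_lintegral_zakTile {d p : ℕ} [NeZero p] {a : ℝ} (ha : 0 < a) (f : L2 d)
    (c : Fin d → ℤ) :
    ENNReal.ofReal ((p : ℝ) ^ d) * ‖f‖ₑ ^ 2 = ENNReal.ofReal (a ^ d) *
      ∫⁻ z, shiftSq p (zakTile a f c 0) z ∂(torusMeasure d).prod (torusMeasure d) := by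
  have hmeas : Measurable fun x => ‖f x‖ₑ ^ 2 := (measurable_Lp f).enorm.pow_const 2
  have hj : ∀ j : Fin d → ℤ, Measurable fun y => ‖f (tile a (j, y))‖ₑ ^ 2 := fun j =>
    hmeas.comp ((measurable_tile a).comp measurable_prodMk_left)
  have h := lintegral_tile ha hmeas
  rw [lintegral_enorm_sq_Lp, ← lintegral_tsum fun j => (hj j).aemeasurable] at h
  rw [h, mul_left_comm]
  congr 1
  rw [lintegral_prod _ (measurable_shiftSq (measurable_zakTile a f c 0)).aemeasurable,
    ← lintegral_const_mul _ (Measurable.tsum hj)]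
  refine lintegral_congr_ae ?_
  filter_upwards [ae_zakSummable_tile ha f c 0] with y hy
  have h0 : Measurable fun θ => ‖zakTile a f c 0 (y, θ)‖ₑ ^ 2 :=
    ((measurable_zakTile a f c 0).comp measurable_prodMk_left).enorm.pow_const 2
  have hs : ∀ s : Fin d → Fin p,
      Measurable fun θ => ‖zakTile a f c 0 (y, θ + torusFrac s)‖ₑ ^ 2 := fun s =>
    h0.comp (measurable_id.add_const _)
  simp only [shiftSq]
  rw [lintegral_finsetSum _ fun s _ => hs s]
  -- By invariance of the torus measure the `p^d` translates contribute equally; this is the factor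
  -- `p^d` on the left-hand side.
  simp only [lintegral_add_right_eq_self (fun θ => ‖zakTile a f c 0 (y, θ)‖ₑ ^ 2)]
  simp only [zakTile, lintegral_enorm_sq_zakTorus hy]
  simp only [add_zero, tile_sub_smul_intVec]
  rw [← (Equiv.addLeft c).tsum_eq fun k => ‖f (tile a (k, y))‖ₑ ^ 2]
  simp [ENNReal.ofReal_pow]

/-! ### Gabor coefficients -/

/-- Since `β a = 1`, the phase is `l · (y - j)` and the integer `l · j` drops out. The modulation
does not see the tile. -/
theorem exp_inner_tile {d : ℕ} {a β : ℝ} (hβ : β * a = 1) (l j : Fin d → ℤ)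
    (y : UnitAddTorus (Fin d)) :
    Complex.exp (2 * Real.pi * Complex.I * ((inner ℝ (β • intVec l) (tile a (j, y)) : ℝ) : ℂ)) =
      mFourier l y := by
  have h : inner ℝ (β • intVec l) (tile a (j, y)) =
      ∑ i, (l i : ℝ) * (circleRep (y i) - j i) := by
    simp only [PiLp.inner_apply, tile, intVec, PiLp.smul_apply, smul_eq_mul, RCLike.inner_apply,
      conj_trivial]
    refine Finset.sum_congr rfl fun i _ => ?_
    linear_combination ((l i : ℝ) * (circleRep (y i) - j i)) * hβ
  rw [h, mFourier, ContinuousMap.coe_mk, Complex.ofReal_sum, Finset.mul_sum, Complex.exp_sum]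
  refine Finset.prod_congr rfl fun i _ => ?_
  conv_rhs => rw [← coe_circleRep (y i)]
  rw [fourier_coe_apply, Complex.exp_eq_exp_iff_exists_int]
  refine ⟨-(l i * j i), ?_⟩
  push_cast
  ring

/-- The correlation of the values of `f` and of the translate of `g` by `v` over a tile. -/
def tileCorr {d : ℕ} (a : ℝ) (f g : L2 d) (v : RSpace d) (y : UnitAddTorus (Fin d)) : ℂ :=
  ∑' j : Fin d → ℤ, (starRingEnd ℂ) (f (tile a (j, y))) * g (tile a (j, y) - v)

theorem integrable_conj_mul_tfShiftFun {d : ℕ} (f g : L2 d) (v ξ : RSpace d) :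
    Integrable fun t => (starRingEnd ℂ) (f t) * tfShiftFun v ξ g t :=
  (Lp.memLp f).star.integrable_mul (memLp_tfShiftFun v ξ g)

theorem integrable_tileCorr {d : ℕ} {a : ℝ} (ha : 0 < a) (f g : L2 d) (v : RSpace d) :
    Integrable (tileCorr a f g v) (torusMeasure d) := by
  have h := (integral_tile ha (integrable_conj_mul_tfShiftFun f g v 0)).1
  simpa only [tfShiftFun, inner_zero_left, Complex.ofReal_zero, mul_zero, Complex.exp_zero,
    one_mul] using! h

/-- The modulation is the same on all tiles and factors out of the sum over `j`. The index is `-l`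
because coefficients are taken against the conjugate character. -/
theorem inner_gaborSystem {d : ℕ} {a α β : ℝ} (ha : 0 < a) (hβ : β * a = 1) (f g : L2 d)
    (k l : Fin d → ℤ) :
    inner ℂ f (gaborSystem g α β (k, l)) =
      ((a ^ d : ℝ) : ℂ) * mFourierCoeff (tileCorr a f g (α • intVec k)) (-l) := by
  have h1 : inner ℂ f (gaborSystem g α β (k, l)) =
      ∫ t, (starRingEnd ℂ) (f t) * tfShiftFun (α • intVec k) (β • intVec l) g t := by
    rw [L2.inner_def]
    refine integral_congr_ae ?_
    filter_upwards [(memLp_tfShiftFun (α • intVec k) (β • intVec l) g).coeFn_toLp] with t ht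
    simp only [gaborSystem, tfShift, RCLike.inner_apply]
    rw [ht, mul_comm]
  rw [h1, (integral_tile ha (integrable_conj_mul_tfShiftFun f g _ _)).2,
    mFourierCoeff_eq_integral_mul, neg_neg]
  congr 1
  refine integral_congr_ae (Eventually.of_forall fun y => ?_)
  simp only [tfShiftFun, exp_inner_tile hβ, tileCorr, ← tsum_mul_left]
  exact tsum_congr fun j => by ring

theorem tsum_enorm_sq_inner_gaborSystem {d : ℕ} {a α β : ℝ} (ha : 0 < a) (hβ : β * a = 1)
    (f g : L2 d) :
    ∑' kl, ‖inner ℂ f (gaborSystem g α β kl)‖ₑ ^ 2 =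
      ENNReal.ofReal (a ^ d) ^ 2 *
        ∑' k : Fin d → ℤ, ∫⁻ y, ‖tileCorr a f g (α • intVec k) y‖ₑ ^ 2 ∂torusMeasure d := by
  rw [ENNReal.tsum_prod', ← ENNReal.tsum_mul_left]
  refine tsum_congr fun k => ?_
  rw [← tsum_enorm_sq_mFourierCoeff (integrable_tileCorr ha f g _), ← ENNReal.tsum_mul_left,
    ← (Equiv.neg (Fin d → ℤ)).tsum_eq]
  refine tsum_congr fun l => ?_
  rw [Equiv.neg_apply, inner_gaborSystem ha hβ, neg_neg, enorm_mul, mul_pow,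
    ← ofReal_norm (((a ^ d : ℝ) : ℂ)), Complex.norm_real, Real.norm_of_nonneg (by positivity)]

/-- Division of `-k` by `q` with remainder `r`. The sign is chosen so that translating `g` by `αk`
produces the points `x + αr` of the rows of the Zak matrix. -/
theorem bijective_mul_sub {d q : ℕ} [NeZero q] : Function.Bijective
    fun (rm : (Fin d → Fin q) × (Fin d → ℤ)) (i : Fin d) => (q : ℤ) * rm.2 i - (rm.1 i : ℕ) := by
  have hq : (0 : ℤ) < q := by exact_mod_cast NeZero.pos q
  constructor
  · rintro ⟨r, m⟩ ⟨r', m'⟩ h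
    have key : ∀ i, r i = r' i ∧ m i = m' i := fun i => by
      have hi : (q : ℤ) * m i - (r i : ℕ) = q * m' i - (r' i : ℕ) := congrFun h i
      have h1 : ((r i : ℕ) : ℤ) < q := by exact_mod_cast (r i).2
      have h2 : ((r' i : ℕ) : ℤ) < q := by exact_mod_cast (r' i).2
      have h3 : m i = m' i := by
        by_contra hne
        rcases lt_or_gt_of_ne hne with hlt | hlt
        · have : (q : ℤ) * (m i + 1) ≤ q * m' i := by gcongr; omega
          rw [mul_add] at this
          omega
        · have : (q : ℤ) * (m' i + 1) ≤ q * m i := by gcongr; omega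
          rw [mul_add] at this
          omega
      refine ⟨Fin.ext ?_, h3⟩
      rw [h3] at hi
      omega
    exact Prod.ext (funext fun i => (key i).1) (funext fun i => (key i).2)
  · intro k
    have hnn : ∀ i, 0 ≤ (-k i) % (q : ℤ) := fun i => Int.emod_nonneg _ hq.ne'
    refine ⟨(fun i => ⟨((-k i) % (q : ℤ)).toNat, ?_⟩, fun i => -((-k i) / q)), funext fun i => ?_⟩
    · have := Int.emod_lt_of_pos (-k i) hq
      have := hnn i
      omega
    · have := Int.mul_ediv_add_emod (-k i) q
      simp only [Int.toNat_of_nonneg (hnn i)]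
      linarith

/-- From `α q = a p`, the translation `α(qm - r)` equals `a p m - αr`: a shift of the lattice `aℤᵈ`
by the index `pm`, together with a change of base point by `αr`. The reference tile `c` is
arbitrary, since the sum over `j` can be reindexed. -/
theorem tileCorr_eq_mFourierCoeff {d p q : ℕ} {a α : ℝ} (hα : α * q = a * p) {f g : L2 d}
    (c m : Fin d → ℤ) (r : Fin d → Fin q) {y : UnitAddTorus (Fin d)}
    (hf : ZakSummable a f (tile a (c, y) + 0))
    (hg : ZakSummable a g (tile a (c, y) + α • finVec r)) :
    tileCorr a f g (α • intVec fun i => (q : ℤ) * m i - (r i : ℕ)) y =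
      mFourierCoeff (fun θ => (starRingEnd ℂ) (zakTile a f c 0 (y, θ)) *
        zakTile a g c (α • finVec r) (y, θ)) (fun i => (p : ℤ) * m i) := by
  simp only [zakTile]
  rw [← tsum_conj_mul_eq_mFourierCoeff hf hg, tileCorr, ← (Equiv.addLeft c).tsum_eq]
  refine tsum_congr fun j => ?_
  rw [Equiv.coe_addLeft, ← tile_sub_smul_intVec, add_zero]
  congr 2
  ext i
  simp only [intVec, finVec, PiLp.sub_apply, PiLp.add_apply, PiLp.smul_apply, smul_eq_mul,
    Pi.add_apply]
  push_cast
  linear_combination (-(m i : ℝ)) * hα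

/-- The frame sum of a Gabor system as an integral in the Zak domain. -/
theorem tsum_enorm_sq_inner_eq_lintegral_shiftMix {d p q : ℕ} [NeZero p] [NeZero q] {a α β : ℝ}
    (ha : 0 < a) (hβ : β * a = 1) (hα : α * q = a * p) (f g : L2 d) (c : Fin d → ℤ) :
    ENNReal.ofReal ((p : ℝ) ^ d) ^ 2 * ∑' kl, ‖inner ℂ f (gaborSystem g α β kl)‖ₑ ^ 2 =
      ENNReal.ofReal (a ^ d) ^ 2 *
        ∫⁻ z, shiftMix p (fun r : Fin d → Fin q => zakTile a g c (α • finVec r))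
          (zakTile a f c 0) z ∂(torusMeasure d).prod (torusMeasure d) := by
  rw [tsum_enorm_sq_inner_gaborSystem ha hβ, mul_left_comm]
  congr 1
  rw [← (Equiv.ofBijective _ (bijective_mul_sub (d := d) (q := q))).tsum_eq, ENNReal.tsum_prod',
    tsum_fintype]
  simp only [shiftMix, Equiv.ofBijective_apply]
  have hterm : ∀ r : Fin d → Fin q, Measurable _ := fun r => measurable_shiftMix_term (p := p)
    (measurable_zakTile a g c (α • finVec r)) (measurable_zakTile a f c 0)
  rw [lintegral_finsetSum _ fun r _ => hterm r, Finset.mul_sum]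
  refine Finset.sum_congr rfl fun r _ => ?_
  have hm : ∀ m : Fin d → ℤ, AEMeasurable (fun y =>
      ‖tileCorr a f g (α • intVec fun i => (q : ℤ) * m i - (r i : ℕ)) y‖ₑ ^ 2) (torusMeasure d) :=
    fun m => (integrable_tileCorr ha f g _).1.aemeasurable.enorm.pow_const 2
  rw [← lintegral_tsum hm, ← lintegral_const_mul'' _ (AEMeasurable.tsum hm),
    lintegral_prod _ (hterm r).aemeasurable]
  refine lintegral_congr_ae ?_
  filter_upwards [ae_zakSummable_tile ha f c 0, ae_zakSummable_tile ha g c (α • finVec r)]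
    with y hf hg
  simp only [tileCorr_eq_mFourierCoeff hα c _ r hf hg]
  have h := tsum_enorm_sq_mFourierCoeff_smul (p := p)
    (integrable_conj_zakTorus_mul a f g (tile a (c, y) + 0) (tile a (c, y) + α • finVec r))
  simp only [zakTile]
  exact h

/-! ### From integral bounds to pointwise bounds -/

theorem shiftSq_indicator {d p : ℕ} {E : Set (UnitAddTorus (Fin d) × UnitAddTorus (Fin d))}
    (hE : ∀ (z : UnitAddTorus (Fin d) × UnitAddTorus (Fin d)) (s : Fin d → Fin p),
      (z.1, z.2 + torusFrac s) ∈ E ↔ z ∈ E)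
    (W : UnitAddTorus (Fin d) × UnitAddTorus (Fin d) → ℂ) :
    shiftSq p (E.indicator W) = E.indicator (shiftSq p W) := by
  funext z
  by_cases hz : z ∈ E <;> simp [shiftSq, Set.indicator, hE, hz]

theorem shiftMix_indicator {d p q : ℕ} {E : Set (UnitAddTorus (Fin d) × UnitAddTorus (Fin d))}
    (hE : ∀ (z : UnitAddTorus (Fin d) × UnitAddTorus (Fin d)) (s : Fin d → Fin p),
      (z.1, z.2 + torusFrac s) ∈ E ↔ z ∈ E)
    (G : (Fin d → Fin q) → UnitAddTorus (Fin d) × UnitAddTorus (Fin d) → ℂ)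
    (W : UnitAddTorus (Fin d) × UnitAddTorus (Fin d) → ℂ) :
    shiftMix p G (E.indicator W) = E.indicator (shiftMix p G W) := by
  funext z
  by_cases hz : z ∈ E <;> simp [shiftMix, Set.indicator, hE, hz]

theorem shiftSq_add {d p : ℕ} [NeZero p] (W : UnitAddTorus (Fin d) × UnitAddTorus (Fin d) → ℂ)
    (z : UnitAddTorus (Fin d) × UnitAddTorus (Fin d)) (t : Fin d → Fin p) :
    shiftSq p W (z.1, z.2 + torusFrac t) = shiftSq p W z := by
  simp only [shiftSq, add_assoc, ← torusFrac_add]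
  exact Equiv.sum_comp (Equiv.addLeft t) fun s => ‖W (z.1, z.2 + torusFrac s)‖ₑ ^ 2

theorem shiftMix_add {d p q : ℕ} [NeZero p]
    (G : (Fin d → Fin q) → UnitAddTorus (Fin d) × UnitAddTorus (Fin d) → ℂ)
    (W : UnitAddTorus (Fin d) × UnitAddTorus (Fin d) → ℂ)
    (z : UnitAddTorus (Fin d) × UnitAddTorus (Fin d)) (t : Fin d → Fin p) :
    shiftMix p G W (z.1, z.2 + torusFrac t) = shiftMix p G W z := by
  simp only [shiftMix, add_assoc, ← torusFrac_add]
  refine Finset.sum_congr rfl fun r _ => ?_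
  rw [← Equiv.sum_comp (Equiv.addLeft t) fun s =>
    (starRingEnd ℂ) (W (z.1, z.2 + torusFrac s)) * G r (z.1, z.2 + torusFrac s)]
  rfl

theorem shiftSq_le {d p : ℕ} {W : UnitAddTorus (Fin d) × UnitAddTorus (Fin d) → ℂ} {C : ℝ≥0∞}
    (hW : ∀ z, ‖W z‖ₑ ≤ C) (z : UnitAddTorus (Fin d) × UnitAddTorus (Fin d)) :
    shiftSq p W z ≤ Fintype.card (Fin d → Fin p) * C ^ 2 := by
  rw [shiftSq, ← nsmul_eq_mul]
  exact Finset.sum_le_card_nsmul _ _ _ fun s _ => pow_le_pow_left' (hW _) 2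

/-- If the set where `w < u` had positive measure, the integrals over it would satisfy the strict
opposite inequality, `w` having finite integral there. -/
theorem ae_le_of_setLIntegral_le {X : Type*} [MeasurableSpace X] {μ : Measure X}
    {u w : X → ℝ≥0∞} (hu : Measurable u) (hw : Measurable w)
    (hfin : ∫⁻ z in {z | w z < u z}, w z ∂μ ≠ ∞)
    (h : ∫⁻ z in {z | w z < u z}, u z ∂μ ≤ ∫⁻ z in {z | w z < u z}, w z ∂μ) : u ≤ᵐ[μ] w := by
  by_contra hne
  have hE : μ {z | w z < u z} ≠ 0 := fun h0 => hne (by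
    rw [EventuallyLE, ae_iff]
    simpa only [not_le] using h0)
  exact absurd h (not_le.2 (setLIntegral_strict_mono (measurableSet_lt hw hu) hE hu hfin
    (Eventually.of_forall fun z hz => hz)))

/-- Bounds for the integrals of `shiftMix` over invariant sets give pointwise bounds. -/
theorem ae_shiftMix_bounds {d p q : ℕ} [NeZero p]
    {μ : Measure (UnitAddTorus (Fin d) × UnitAddTorus (Fin d))} [IsFiniteMeasure μ]
    {G : (Fin d → Fin q) → UnitAddTorus (Fin d) × UnitAddTorus (Fin d) → ℂ}
    (hG : ∀ r, Measurable (G r)) {A B : ℝ≥0∞} (hA : A ≠ ∞) (hB : B ≠ ∞)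
    (h : ∀ W : UnitAddTorus (Fin d) × UnitAddTorus (Fin d) → ℂ, Measurable W →
      (∃ C : NNReal, ∀ z, ‖W z‖ₑ ≤ C) →
      A * ∫⁻ z, shiftSq p W z ∂μ ≤ ∫⁻ z, shiftMix p G W z ∂μ ∧
        ∫⁻ z, shiftMix p G W z ∂μ ≤ B * ∫⁻ z, shiftSq p W z ∂μ)
    {W : UnitAddTorus (Fin d) × UnitAddTorus (Fin d) → ℂ} (hW : Measurable W)
    (hC : ∃ C : NNReal, ∀ z, ‖W z‖ₑ ≤ C) :
    ∀ᵐ z ∂μ, A * shiftSq p W z ≤ shiftMix p G W z ∧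
      shiftMix p G W z ≤ B * shiftSq p W z := by
  have hS := measurable_shiftSq (p := p) hW
  have hM := measurable_shiftMix (p := p) hG hW
  have hfin : ∀ (D : ℝ≥0∞) (E : Set (UnitAddTorus (Fin d) × UnitAddTorus (Fin d))), D ≠ ∞ →
      ∫⁻ z in E, D * shiftSq p W z ∂μ ≠ ∞ := fun D E hD => by
    obtain ⟨C, hC⟩ := hC
    refine ne_top_of_le_ne_top ?_ (lintegral_mono fun z => mul_le_mul_right (shiftSq_le hC z) D)
    rw [lintegral_const]
    finiteness
  -- Cutting `W` off by an invariant set cuts off `shiftSq` and `shiftMix` by the same set. The sets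
  -- where a pointwise bound fails are invariant, so they are admissible below.
  have hloc : ∀ E : Set (UnitAddTorus (Fin d) × UnitAddTorus (Fin d)), MeasurableSet E →
      (∀ z (s : Fin d → Fin p), (z.1, z.2 + torusFrac s) ∈ E ↔ z ∈ E) →
      ∫⁻ z in E, A * shiftSq p W z ∂μ ≤ ∫⁻ z in E, shiftMix p G W z ∂μ ∧
        ∫⁻ z in E, shiftMix p G W z ∂μ ≤ ∫⁻ z in E, B * shiftSq p W z ∂μ := by
    intro E hE hinv
    have hb : ∃ C : NNReal, ∀ z, ‖E.indicator W z‖ₑ ≤ C := by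
      obtain ⟨C, hC⟩ := hC
      refine ⟨C, fun z => le_trans ?_ (hC z)⟩
      by_cases hz : z ∈ E <;> simp [hz]
    have := h (E.indicator W) (hW.indicator hE) hb
    rw [shiftSq_indicator hinv, shiftMix_indicator hinv, lintegral_indicator hE,
      lintegral_indicator hE] at this
    rwa [lintegral_const_mul _ hS, lintegral_const_mul _ hS]
  have h1 : (fun z => A * shiftSq p W z) ≤ᵐ[μ] shiftMix p G W := by
    have hE := (hloc _ (measurableSet_lt hM (hS.const_mul A)) fun z s => by
      simp only [Set.mem_ofPred_eq, shiftSq_add, shiftMix_add]).1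
    refine ae_le_of_setLIntegral_le (hS.const_mul A) hM ?_ hE
    refine ne_top_of_le_ne_top (hfin A {z | shiftMix p G W z < A * shiftSq p W z} hA)
      (setLIntegral_mono (hS.const_mul A) fun z hz => le_of_lt hz)
  have h2 : shiftMix p G W ≤ᵐ[μ] fun z => B * shiftSq p W z := by
    have hE := (hloc _ (measurableSet_lt (hS.const_mul B) hM) fun z s => by
      simp only [Set.mem_ofPred_eq, shiftSq_add, shiftMix_add]).2
    exact ae_le_of_setLIntegral_le hM (hS.const_mul B) (hfin B _ hB) hE
  filter_upwards [h1, h2] with z hz1 hz2 using ⟨hz1, hz2⟩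

/-- The matrix with rows indexed by `r` and entries `M r s` satisfies two-sided norm bounds. -/
def MatrixBound {R S : Type*} [Fintype R] [Fintype S] (A B : ℝ≥0∞) (M : R → S → ℂ) : Prop :=
  ∀ v : S → ℂ, A * ∑ s, ‖v s‖ₑ ^ 2 ≤ ∑ r, ‖∑ s, M r s * v s‖ₑ ^ 2 ∧
    ∑ r, ‖∑ s, M r s * v s‖ₑ ^ 2 ≤ B * ∑ s, ‖v s‖ₑ ^ 2

theorem matrixBound_of_dense {R S : Type*} [Fintype R] [Fintype S] {A B : ℝ≥0∞}
    (hA : A ≠ ∞) (hB : B ≠ ∞) {M : R → S → ℂ} {ι : Type*} {v : ι → S → ℂ} (hv : DenseRange v)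
    (h : ∀ i, A * ∑ s, ‖v i s‖ₑ ^ 2 ≤ ∑ r, ‖∑ s, (starRingEnd ℂ) (v i s) * M r s‖ₑ ^ 2 ∧
      ∑ r, ‖∑ s, (starRingEnd ℂ) (v i s) * M r s‖ₑ ^ 2 ≤ B * ∑ s, ‖v i s‖ₑ ^ 2) :
    MatrixBound A B M := by
  have hc1 : Continuous fun v : S → ℂ => ∑ s, ‖v s‖ₑ ^ 2 :=
    continuous_finsetSum _ fun s _ =>
      (ENNReal.continuous_pow 2).comp (continuous_enorm.comp (continuous_apply s))
  have hc2 : Continuous fun v : S → ℂ => ∑ r, ‖∑ s, (starRingEnd ℂ) (v s) * M r s‖ₑ ^ 2 :=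
    continuous_finsetSum _ fun r _ => (ENNReal.continuous_pow 2).comp
      (continuous_enorm.comp (continuous_finsetSum _ fun s _ =>
        (Complex.continuous_conj.comp (continuous_apply s)).mul continuous_const))
  have key : ∀ w : S → ℂ,
      A * ∑ s, ‖w s‖ₑ ^ 2 ≤ ∑ r, ‖∑ s, (starRingEnd ℂ) (w s) * M r s‖ₑ ^ 2 ∧
      ∑ r, ‖∑ s, (starRingEnd ℂ) (w s) * M r s‖ₑ ^ 2 ≤ B * ∑ s, ‖w s‖ₑ ^ 2 := fun w =>
    hv.induction_on w
      ((isClosed_le ((ENNReal.continuous_const_mul hA).comp hc1) hc2).inter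
        (isClosed_le hc2 ((ENNReal.continuous_const_mul hB).comp hc1))) h
  intro w
  have he : ∀ z : ℂ, ‖(starRingEnd ℂ) z‖ₑ = ‖z‖ₑ := fun z => by
    rw [← ofReal_norm, RCLike.norm_conj, ofReal_norm]
  have := key fun s => (starRingEnd ℂ) (w s)
  simpa only [he, Complex.conj_conj, mul_comm] using this

theorem ae_matrixBound {d p q : ℕ} [NeZero p]
    {μ : Measure (UnitAddTorus (Fin d) × UnitAddTorus (Fin d))} [IsFiniteMeasure μ]
    {G : (Fin d → Fin q) → UnitAddTorus (Fin d) × UnitAddTorus (Fin d) → ℂ}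
    (hG : ∀ r, Measurable (G r)) {A B : ℝ≥0∞} (hA : A ≠ ∞) (hB : B ≠ ∞)
    (h : ∀ W : UnitAddTorus (Fin d) × UnitAddTorus (Fin d) → ℂ, Measurable W →
      (∃ C : NNReal, ∀ z, ‖W z‖ₑ ≤ C) →
      A * ∫⁻ z, shiftSq p W z ∂μ ≤ ∫⁻ z, shiftMix p G W z ∂μ ∧
        ∫⁻ z, shiftMix p G W z ∂μ ≤ B * ∫⁻ z, shiftSq p W z ∂μ) :
    ∀ᵐ z ∂μ, MatrixBound A B fun r (s : Fin d → Fin p) => G r (z.1, z.2 + torusFrac s) := by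
  classical
  let 𝓑 := TopologicalSpace.countableBasis (UnitAddTorus (Fin d))
  have h𝓑 := TopologicalSpace.isBasis_countableBasis (UnitAddTorus (Fin d))
  have : Countable 𝓑 := (TopologicalSpace.countable_countableBasis _).to_subtype
  -- A countable family of test functions: one vector of a dense sequence, with each coordinate
  -- placed on a basic open set. Countability gives one null set for all of them.
  let W : ℕ × ((Fin d → Fin p) → 𝓑) → UnitAddTorus (Fin d) × UnitAddTorus (Fin d) → ℂ :=
    fun i z => ∑ s : Fin d → Fin p,
      (i.2 s : Set (UnitAddTorus (Fin d))).indicator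
        (fun _ => TopologicalSpace.denseSeq ((Fin d → Fin p) → ℂ) i.1 s) z.2
  have hWm : ∀ i, Measurable (W i) := fun i =>
    Finset.measurable_fun_sum _ fun s _ =>
      (measurable_const.indicator (h𝓑.isOpen (i.2 s).2).measurableSet).comp measurable_snd
  have hWb : ∀ i, ∃ C : NNReal, ∀ z, ‖W i z‖ₑ ≤ C := fun i => by
    refine ⟨∑ s, ‖TopologicalSpace.denseSeq ((Fin d → Fin p) → ℂ) i.1 s‖₊, fun z => ?_⟩
    rw [enorm_eq_nnnorm, ENNReal.coe_le_coe]
    refine (nnnorm_sum_le _ _).trans (Finset.sum_le_sum fun s _ => ?_)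
    by_cases hz : z.2 ∈ (i.2 s : Set (UnitAddTorus (Fin d))) <;> simp [hz]
  filter_upwards [ae_all_iff.2 fun i => ae_shiftMix_bounds hG hA hB h (hWm i) (hWb i)] with z hz
  refine matrixBound_of_dense hA hB
    (TopologicalSpace.denseRange_denseSeq ((Fin d → Fin p) → ℂ)) fun n => ?_
  let x : (Fin d → Fin p) → UnitAddTorus (Fin d) := fun s => z.2 + torusFrac s
  have hx : Function.Injective x := (add_right_injective z.2).comp torusFrac_injective
  -- The points `θ + s/p` are distinct, so basic neighbourhoods separate them. The corresponding
  -- test function takes at these points exactly the coordinates of the chosen vector.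
  obtain ⟨U, hU, hdisj⟩ := (Set.finite_range x).t2_separation
  have hbasis : ∀ s, ∃ b : 𝓑, x s ∈ (b : Set (UnitAddTorus (Fin d))) ∧
      (b : Set (UnitAddTorus (Fin d))) ⊆ U (x s) := fun s => by
    obtain ⟨b, hb, h1, h2⟩ := h𝓑.exists_subset_of_mem_open (hU (x s)).1 (hU (x s)).2
    exact ⟨⟨b, hb⟩, h1, h2⟩
  choose b hb1 hb2 using hbasis
  have hW : ∀ s, W (n, b) (z.1, z.2 + torusFrac s) =
      TopologicalSpace.denseSeq ((Fin d → Fin p) → ℂ) n s := fun s => by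
    change ∑ t, (b t : Set (UnitAddTorus (Fin d))).indicator _ (x s) = _
    rw [Finset.sum_eq_single s]
    · rw [Set.indicator_of_mem (hb1 s)]
    · intro t _ hts
      refine Set.indicator_of_notMem (fun hmem => ?_) _
      exact Set.disjoint_left.1 (hdisj ⟨t, rfl⟩ ⟨s, rfl⟩ (hx.ne hts)) (hb2 t hmem) (hU (x s)).1
    · simp
  simpa only [shiftSq, shiftMix, hW] using hz (n, b)

/-! ### Functions with a prescribed Zak transform -/

theorem measurable_mFourierCoeff {d : ℕ} {Y : Type*} [MeasurableSpace Y]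
    {W : Y × UnitAddTorus (Fin d) → ℂ} (hW : Measurable W) (k : Fin d → ℤ) :
    Measurable fun y => mFourierCoeff (fun θ => W (y, θ)) k := by
  simp only [mFourierCoeff_eq_integral_mul]
  have : StronglyMeasurable fun z : Y × UnitAddTorus (Fin d) => mFourier (-k) z.2 * W z :=
    (((mFourier (-k)).continuous.measurable.comp measurable_snd).mul hW).stronglyMeasurable
  exact this.integral_prod_right'.measurable

/-- Inverse Zak transform: the value of `f` at `tile a (j, y)` is the Fourier coefficient of `W(y,
·)` of index `j - c`. The offset is needed because the coefficient of index `k` over tile `c`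
samples `f` on tile `c + k`. Parseval in each fibre shows that `f` is in `L²`. -/
theorem exists_zakTile_ae_eq {d : ℕ} {a : ℝ} (ha : 0 < a) (c : Fin d → ℤ)
    {W : UnitAddTorus (Fin d) × UnitAddTorus (Fin d) → ℂ} (hW : Measurable W)
    (hC : ∃ C : NNReal, ∀ z, ‖W z‖ₑ ≤ C) :
    ∃ f : L2 d, zakTile a f c 0 =ᵐ[(torusMeasure d).prod (torusMeasure d)] W := by
  obtain ⟨C, hC⟩ := hC
  have hmemLp : ∀ y, MemLp (fun θ => W (y, θ)) 2 (torusMeasure d) := fun y =>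
    MemLp.of_bound (hW.comp measurable_prodMk_left).aestronglyMeasurable C
      (Eventually.of_forall fun θ => by
        have := hC (y, θ)
        rw [enorm_eq_nnnorm, ENNReal.coe_le_coe] at this
        exact_mod_cast this)
  have hint : ∀ y, Integrable (fun θ => W (y, θ)) (torusMeasure d) := fun y =>
    (hmemLp y).integrable (by norm_num)
  let h : (Fin d → ℤ) × UnitAddTorus (Fin d) → ℂ := fun w =>
    mFourierCoeff (fun θ => W (w.2, θ)) (w.1 - c)
  have hh : Measurable h := measurable_from_prod_countable_right fun j =>
    measurable_mFourierCoeff hW (j - c)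
  let f₀ : RSpace d → ℂ := fun x => h (untile a x)
  have hf₀ : Measurable f₀ := hh.comp (measurable_untile a)
  have hsq : ∫⁻ x, ‖f₀ x‖ₑ ^ 2 ≠ ∞ := by
    rw [lintegral_tile ha (hf₀.enorm.pow_const 2)]
    have hj : ∀ j, Measurable fun y => ‖h (j, y)‖ₑ ^ 2 := fun j =>
      (hh.comp measurable_prodMk_left).enorm.pow_const 2
    simp only [f₀, untile_tile ha]
    rw [← lintegral_tsum fun j => (hj j).aemeasurable]
    refine ENNReal.mul_ne_top ENNReal.ofReal_ne_top (ne_top_of_le_ne_top (b := (C : ℝ≥0∞) ^ 2)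
      (by finiteness) ?_)
    have hy : ∀ y, ∑' j, ‖h (j, y)‖ₑ ^ 2 ≤ (C : ℝ≥0∞) ^ 2 := fun y => by
      rw [← (Equiv.addRight c).tsum_eq]
      simp only [h, Equiv.coe_addRight, add_sub_cancel_right]
      rw [tsum_enorm_sq_mFourierCoeff (hint y)]
      refine (lintegral_mono fun θ => pow_le_pow_left' (hC (y, θ)) 2).trans ?_
      simp
    refine (lintegral_mono hy).trans ?_
    simp
  have hm := memLp_two_of_lintegral_enorm_sq_ne_top hf₀.aestronglyMeasurable hsq
  refine ⟨hm.toLp f₀, ?_⟩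
  have hae : ∀ᵐ y ∂torusMeasure d, ∀ k, hm.toLp f₀ (tile a (k, y)) = f₀ (tile a (k, y)) :=
    ae_all_iff.2 fun k => ae_tile ha hm.coeFn_toLp k
  have hfib : ∀ᵐ y ∂torusMeasure d, ∀ᵐ θ ∂torusMeasure d,
      zakTile a (hm.toLp f₀) c 0 (y, θ) = W (y, θ) := by
    filter_upwards [hae, ae_zakSummable_tile ha (hm.toLp f₀) c 0] with y hy hsum
    have hi : Integrable (fun θ => zakTile a (hm.toLp f₀) c 0 (y, θ)) (torusMeasure d) :=
      (memLp_zakTorus a (hm.toLp f₀) (tile a (c, y) + 0)).integrable (by norm_num)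
    refine ae_eq_of_mFourierCoeff_eq hi (hint y) fun k => ?_
    simp only [zakTile]
    rw [mFourierCoeff_congr_ae (zakTorus_ae_eq a (hm.toLp f₀) _), mFourierCoeff_zakFiber hsum,
      add_zero, tile_sub_smul_intVec, hy]
    simp only [f₀, untile_tile ha, h, add_sub_cancel_left]
  exact (Measure.ae_prod_iff_ae_ae
    (measurableSet_eq_fun (measurable_zakTile a _ c 0) hW)).2 hfib

theorem ae_comp_torusFrac {d p : ℕ} {P : UnitAddTorus (Fin d) × UnitAddTorus (Fin d) → Prop}
    (h : ∀ᵐ z ∂(torusMeasure d).prod (torusMeasure d), P z) :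
    ∀ᵐ z ∂(torusMeasure d).prod (torusMeasure d), ∀ s : Fin d → Fin p,
      P (z.1, z.2 + torusFrac s) := by
  refine ae_all_iff.2 fun s => ?_
  exact ((MeasurePreserving.id (torusMeasure d)).prod
    (measurePreserving_add_right (torusMeasure d) (torusFrac s))).quasiMeasurePreserving.ae h

theorem shiftSq_congr_ae {d p : ℕ} {W W' : UnitAddTorus (Fin d) × UnitAddTorus (Fin d) → ℂ}
    (h : W =ᵐ[(torusMeasure d).prod (torusMeasure d)] W') :
    shiftSq p W =ᵐ[(torusMeasure d).prod (torusMeasure d)] shiftSq p W' := by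
  filter_upwards [ae_comp_torusFrac (p := p) h] with z hz
  simp only [shiftSq, hz]

theorem shiftMix_congr_ae {d p q : ℕ}
    (G : (Fin d → Fin q) → UnitAddTorus (Fin d) × UnitAddTorus (Fin d) → ℂ)
    {W W' : UnitAddTorus (Fin d) × UnitAddTorus (Fin d) → ℂ}
    (h : W =ᵐ[(torusMeasure d).prod (torusMeasure d)] W') :
    shiftMix p G W =ᵐ[(torusMeasure d).prod (torusMeasure d)] shiftMix p G W' := by
  filter_upwards [ae_comp_torusFrac (p := p) h] with z hz
  simp only [shiftMix, hz]

/-! ### Singular values -/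

/-- Expand `⟨v, T* T v⟩` in an orthonormal eigenbasis of `T* T`, whose eigenvalues are the squared
singular values. -/
theorem norm_sq_eq_sum_singularValues {E F : Type*} [NormedAddCommGroup E] [InnerProductSpace ℂ E]
    [FiniteDimensional ℂ E] [NormedAddCommGroup F] [InnerProductSpace ℂ F] [FiniteDimensional ℂ F]
    (T : E →ₗ[ℂ] F) {n : ℕ} (hn : Module.finrank ℂ E = n) (v : E) :
    ‖T v‖ ^ 2 = ∑ i : Fin n, T.singularValues i ^ 2 *
      ‖inner ℂ (T.isSymmetric_adjoint_comp_self.eigenvectorBasis hn i) v‖ ^ 2 := by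
  set hS := T.isSymmetric_adjoint_comp_self
  set b := hS.eigenvectorBasis hn
  have h1 : ((‖T v‖ ^ 2 : ℝ) : ℂ) = inner ℂ v ((LinearMap.adjoint T ∘ₗ T) v) := by
    rw [LinearMap.comp_apply, LinearMap.adjoint_inner_right, inner_self_eq_norm_sq_to_K]
    simp
  have h2 : ∀ i, inner ℂ (b i) ((LinearMap.adjoint T ∘ₗ T) v) =
      ((T.singularValues i ^ 2 : ℝ) : ℂ) * inner ℂ (b i) v := fun i => by
    rw [← hS (b i) v, hS.apply_eigenvectorBasis, inner_smul_left, T.sq_singularValues_fin hn]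
    simp [b]
  rw [← b.sum_inner_mul_inner] at h1
  simp only [h2] at h1
  apply Complex.ofReal_injective
  rw [h1, Complex.ofReal_sum]
  refine Finset.sum_congr rfl fun i _ => ?_
  have h3 : inner ℂ v (b i) * inner ℂ (b i) v = ((‖inner ℂ (b i) v‖ ^ 2 : ℝ) : ℂ) := by
    rw [← inner_conj_symm, RCLike.conj_mul]
    simp
  rw [mul_left_comm, h3, Complex.ofReal_mul]

theorem singularValues_mem_Icc_iff {E F : Type*} [NormedAddCommGroup E] [InnerProductSpace ℂ E]
    [FiniteDimensional ℂ E] [NormedAddCommGroup F] [InnerProductSpace ℂ F] [FiniteDimensional ℂ F]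
    (T : E →ₗ[ℂ] F) {n : ℕ} (hn : Module.finrank ℂ E = n) {A B : ℝ} (hB : 0 ≤ B) :
    (∀ i < n, T.singularValues i ∈ Set.Icc (√A) (√B)) ↔
      ∀ v, A * ‖v‖ ^ 2 ≤ ‖T v‖ ^ 2 ∧ ‖T v‖ ^ 2 ≤ B * ‖v‖ ^ 2 := by
  have hmem : ∀ i, T.singularValues i ∈ Set.Icc (√A) (√B) ↔
      A ≤ T.singularValues i ^ 2 ∧ T.singularValues i ^ 2 ≤ B := fun i => by
    rw [Set.mem_Icc, Real.sqrt_le_left (T.singularValues_nonneg i),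
      Real.le_sqrt (T.singularValues_nonneg i) hB]
  simp only [hmem]
  set b := T.isSymmetric_adjoint_comp_self.eigenvectorBasis hn with hb
  constructor
  · intro h v
    rw [norm_sq_eq_sum_singularValues T hn, ← b.sum_sq_norm_inner_right v, Finset.mul_sum,
      Finset.mul_sum]
    exact ⟨Finset.sum_le_sum fun i _ => mul_le_mul_of_nonneg_right (h i i.2).1 (by positivity),
      Finset.sum_le_sum fun i _ => mul_le_mul_of_nonneg_right (h i i.2).2 (by positivity)⟩
  · intro h i hi
    -- Testing the norm bounds on the eigenvectors isolates each singular value.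
    have h1 : ‖T (b ⟨i, hi⟩)‖ ^ 2 = T.singularValues i ^ 2 := by
      rw [norm_sq_eq_sum_singularValues T hn, ← hb, Finset.sum_eq_single ⟨i, hi⟩]
      · simp
      · intro j _ hj
        rw [b.inner_eq_zero hj]
        simp
      · simp
    have h2 := h (b ⟨i, hi⟩)
    rw [b.norm_eq_one, h1, one_pow, mul_one, mul_one] at h2
    exact h2

theorem enorm_sq_eq_ofReal {E : Type*} [SeminormedAddGroup E] (z : E) :
    ‖z‖ₑ ^ 2 = ENNReal.ofReal (‖z‖ ^ 2) := by
  rw [ENNReal.ofReal_pow (norm_nonneg _), ofReal_norm]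

theorem singularValues_toEuclideanLin_mem_Icc_iff {R S : Type*} [Fintype R] [Fintype S]
    [DecidableEq S] (M : Matrix R S ℂ) {n : ℕ} (hn : Fintype.card S = n) {A B : ℝ} (hA : 0 ≤ A)
    (hB : 0 ≤ B) :
    (∀ i < n, (Matrix.toEuclideanLin M).singularValues i ∈ Set.Icc (√A) (√B)) ↔
      MatrixBound (ENNReal.ofReal A) (ENNReal.ofReal B) M := by
  rw [singularValues_mem_Icc_iff _ (by rw [finrank_euclideanSpace, hn]) hB,
    (WithLp.equiv 2 (S → ℂ)).forall_congr_left]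
  refine forall_congr' fun v => ?_
  simp only [EuclideanSpace.norm_sq_eq, enorm_sq_eq_ofReal]
  rw [← ENNReal.ofReal_sum_of_nonneg (fun _ _ => by positivity),
    ← ENNReal.ofReal_sum_of_nonneg (fun _ _ => by positivity), ← ENNReal.ofReal_mul hA,
    ← ENNReal.ofReal_mul hB, ENNReal.ofReal_le_ofReal_iff (by positivity),
    ENNReal.ofReal_le_ofReal_iff (by positivity)]
  rfl

/-! ### The frame inequality in `[0, ∞]` -/

/-- In `[0, ∞]` the finite upper bound already encodes summability. -/
theorem frame_inequality_iff {ι H : Type*} [NormedAddCommGroup H] [InnerProductSpace ℂ H]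
    (φ : ι → H) {A B : ℝ} (hA : 0 ≤ A) (hB : 0 ≤ B) (f : H) :
    (Summable (fun i => ‖inner ℂ f (φ i)‖ ^ 2) ∧
      A * ‖f‖ ^ 2 ≤ ∑' i, ‖inner ℂ f (φ i)‖ ^ 2 ∧ ∑' i, ‖inner ℂ f (φ i)‖ ^ 2 ≤ B * ‖f‖ ^ 2) ↔
    ENNReal.ofReal A * ‖f‖ₑ ^ 2 ≤ ∑' i, ‖inner ℂ f (φ i)‖ₑ ^ 2 ∧
      ∑' i, ‖inner ℂ f (φ i)‖ₑ ^ 2 ≤ ENNReal.ofReal B * ‖f‖ₑ ^ 2 := by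
  simp only [enorm_sq_eq_ofReal]
  by_cases hs : Summable fun i => ‖inner ℂ f (φ i)‖ ^ 2
  · rw [← ENNReal.ofReal_tsum_of_nonneg (fun _ => by positivity) hs, ← ENNReal.ofReal_mul hA,
      ← ENNReal.ofReal_mul hB,
      ENNReal.ofReal_le_ofReal_iff (tsum_nonneg fun _ => by positivity),
      ENNReal.ofReal_le_ofReal_iff (by positivity)]
    simp only [hs, true_and]
  · refine iff_of_false (fun h => hs h.1) fun h => hs ?_
    have hfin : ∑' i, ENNReal.ofReal (‖inner ℂ f (φ i)‖ ^ 2) ≠ ∞ :=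
      ne_top_of_le_ne_top (by finiteness) h.2
    simpa [ENNReal.toReal_ofReal, sq_nonneg] using ENNReal.summable_toReal hfin

theorem eq_ofReal_div_mul {a b : ℝ} (hb : 0 < b) {x y : ℝ≥0∞}
    (h : ENNReal.ofReal b * x = ENNReal.ofReal a * y) : x = ENNReal.ofReal (a / b) * y := by
  rw [ENNReal.ofReal_div_of_pos hb, div_eq_mul_inv, mul_right_comm, ← h, mul_right_comm,
    ENNReal.mul_inv_cancel (by simpa using hb) ENNReal.ofReal_ne_top, one_mul]

theorem enorm_sq_eq_mul_lintegral_shiftSq {d p : ℕ} [NeZero p] {a : ℝ} (ha : 0 < a) (f : L2 d)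
    (c : Fin d → ℤ) :
    ‖f‖ₑ ^ 2 = ENNReal.ofReal (a ^ d / p ^ d) *
      ∫⁻ z, shiftSq p (zakTile a f c 0) z ∂(torusMeasure d).prod (torusMeasure d) :=
  eq_ofReal_div_mul (pow_pos (Nat.cast_pos.2 (NeZero.pos p)) d)
    (enorm_sq_eq_lintegral_zakTile ha f c)

theorem tsum_enorm_sq_inner_eq_mul_lintegral_shiftMix {d p q : ℕ} [NeZero p] [NeZero q]
    {a α β : ℝ} (ha : 0 < a) (hβ : β * a = 1) (hα : α * q = a * p) (f g : L2 d)
    (c : Fin d → ℤ) :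
    ∑' kl, ‖inner ℂ f (gaborSystem g α β kl)‖ₑ ^ 2 =
      ENNReal.ofReal (a ^ d / p ^ d) * (ENNReal.ofReal (a ^ d / p ^ d) *
        ∫⁻ z, shiftMix p (fun r : Fin d → Fin q => zakTile a g c (α • finVec r))
          (zakTile a f c 0) z ∂(torusMeasure d).prod (torusMeasure d)) := by
  have hp : (0 : ℝ) < p ^ d := pow_pos (Nat.cast_pos.2 (NeZero.pos p)) d
  have h := tsum_enorm_sq_inner_eq_lintegral_shiftMix ha hβ hα f g c
  rw [sq, sq, mul_assoc, mul_assoc] at h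
  refine eq_ofReal_div_mul hp ?_
  rw [mul_left_comm]
  refine eq_ofReal_div_mul hp ?_
  rw [h]

theorem frame_bound_of_matrixBound {d p q : ℕ} [NeZero p] [NeZero q] {a α β : ℝ}
    (ha : 0 < a) (hβ : β * a = 1) (hα : α * q = a * p) (g : L2 d) (c : Fin d → ℤ) {A B : ℝ≥0∞}
    (h : ∀ᵐ z ∂(torusMeasure d).prod (torusMeasure d), MatrixBound A B
      fun (r : Fin d → Fin q) (s : Fin d → Fin p) =>
        zakTile a g c (α • finVec r) (z.1, z.2 + torusFrac s)) (f : L2 d) :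
    ENNReal.ofReal (a ^ d / p ^ d) * A * ‖f‖ₑ ^ 2 ≤
        ∑' kl, ‖inner ℂ f (gaborSystem g α β kl)‖ₑ ^ 2 ∧
      ∑' kl, ‖inner ℂ f (gaborSystem g α β kl)‖ₑ ^ 2 ≤
        ENNReal.ofReal (a ^ d / p ^ d) * B * ‖f‖ₑ ^ 2 := by
  have he : ∀ z : ℂ, ‖(starRingEnd ℂ) z‖ₑ = ‖z‖ₑ := fun z => by
    rw [← ofReal_norm, RCLike.norm_conj, ofReal_norm]
  have hpt : ∀ᵐ z ∂(torusMeasure d).prod (torusMeasure d),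
      A * shiftSq p (zakTile a f c 0) z ≤
          shiftMix p (fun r : Fin d → Fin q => zakTile a g c (α • finVec r)) (zakTile a f c 0) z ∧
        shiftMix p (fun r : Fin d → Fin q => zakTile a g c (α • finVec r)) (zakTile a f c 0) z ≤
          B * shiftSq p (zakTile a f c 0) z := by
    filter_upwards [h] with z hz
    -- The inner product is conjugate linear in `f`, so the Zak matrix acts on the conjugate of the
    -- vector of values of `Z f`.
    have := hz fun s => (starRingEnd ℂ) (zakTile a f c 0 (z.1, z.2 + torusFrac s))
    simpa only [he, shiftSq, shiftMix, mul_comm] using this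
  have hS := measurable_shiftSq (p := p) (measurable_zakTile a f c 0)
  rw [tsum_enorm_sq_inner_eq_mul_lintegral_shiftMix ha hβ hα f g c,
    enorm_sq_eq_mul_lintegral_shiftSq (p := p) ha f c, mul_assoc, mul_assoc, mul_left_comm A,
    mul_left_comm B, ← lintegral_const_mul _ hS, ← lintegral_const_mul _ hS]
  constructor
  · gcongr 2
    exact lintegral_mono_ae (hpt.mono fun z hz => hz.1)
  · gcongr 2
    exact lintegral_mono_ae (hpt.mono fun z hz => hz.2)

theorem matrixBound_of_frame_bound {d p q : ℕ} [NeZero p] [NeZero q] {a α β : ℝ}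
    (ha : 0 < a) (hβ : β * a = 1) (hα : α * q = a * p) (g : L2 d) (c : Fin d → ℤ) {A B : ℝ≥0∞}
    (hA : A ≠ ∞) (hB : B ≠ ∞)
    (h : ∀ f : L2 d, ENNReal.ofReal (a ^ d / p ^ d) * A * ‖f‖ₑ ^ 2 ≤
        ∑' kl, ‖inner ℂ f (gaborSystem g α β kl)‖ₑ ^ 2 ∧
      ∑' kl, ‖inner ℂ f (gaborSystem g α β kl)‖ₑ ^ 2 ≤
        ENNReal.ofReal (a ^ d / p ^ d) * B * ‖f‖ₑ ^ 2) :
    ∀ᵐ z ∂(torusMeasure d).prod (torusMeasure d), MatrixBound A B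
      fun (r : Fin d → Fin q) (s : Fin d → Fin p) =>
        zakTile a g c (α • finVec r) (z.1, z.2 + torusFrac s) := by
  refine ae_matrixBound (G := fun r => zakTile a g c (α • finVec r))
    (fun r => measurable_zakTile a g c _) hA hB fun W hW hC => ?_
  obtain ⟨f, hf⟩ := exists_zakTile_ae_eq ha c hW hC
  have hp : (0 : ℝ) < p ^ d := pow_pos (Nat.cast_pos.2 (NeZero.pos p)) d
  have hκ : ENNReal.ofReal (a ^ d / p ^ d) ≠ 0 := by
    simpa using div_pos (pow_pos ha d) hp
  have := h f
  rw [tsum_enorm_sq_inner_eq_mul_lintegral_shiftMix ha hβ hα f g c,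
    enorm_sq_eq_mul_lintegral_shiftSq (p := p) ha f c, mul_assoc, mul_assoc, mul_left_comm A,
    mul_left_comm B, ENNReal.mul_le_mul_iff_right hκ ENNReal.ofReal_ne_top,
    ENNReal.mul_le_mul_iff_right hκ ENNReal.ofReal_ne_top,
    ENNReal.mul_le_mul_iff_right hκ ENNReal.ofReal_ne_top,
    ENNReal.mul_le_mul_iff_right hκ ENNReal.ofReal_ne_top,
    lintegral_congr_ae (shiftSq_congr_ae hf), lintegral_congr_ae (shiftMix_congr_ae _ hf)] at this
  exact this

/-! ### Transfer of almost everywhere statements -/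

theorem quasiMeasurePreserving_tile_left {d : ℕ} {a : ℝ} (ha : 0 < a) (c : Fin d → ℤ) :
    Measure.QuasiMeasurePreserving (fun y => tile a (c, y)) (torusMeasure d) volume :=
  ⟨(measurable_tile a).comp measurable_prodMk_left, Measure.AbsolutelyContinuous.mk
    fun s hs h0 => by
      have hm : Measurable fun y => tile a (c, y) := (measurable_tile a).comp measurable_prodMk_left
      rw [Measure.map_apply hm hs]
      have := ae_tile ha (P := fun x => x ∉ s) (measure_eq_zero_iff_ae_notMem.1 h0) c
      exact measure_eq_zero_iff_ae_notMem.2 this⟩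

theorem quasiMeasurePreserving_untile_snd {d : ℕ} {a : ℝ} (ha : 0 < a) :
    Measure.QuasiMeasurePreserving (fun x => (untile (d := d) a x).2) volume (torusMeasure d) :=
  Measure.quasiMeasurePreserving_snd.comp (quasiMeasurePreserving_untile ha)

/-- A property of `x` and of the class of `ξ` modulo `ℤᵈ` holds almost everywhere if and only if
it does so on the product of each tile and the torus. -/
theorem ae_prod_iff_forall_tile {d : ℕ} {a : ℝ} (ha : 0 < a)
    {P : RSpace d → UnitAddTorus (Fin d) → Prop} :
    (∀ᵐ z : RSpace d × RSpace d, P z.1 (untile 1 z.2).2) ↔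
      ∀ c, ∀ᵐ z ∂(torusMeasure d).prod (torusMeasure d), P (tile a (c, z.1)) z.2 := by
  constructor
  · intro h c
    have hq := QuasiMeasurePreserving.prodMap (quasiMeasurePreserving_tile_left ha c)
      (quasiMeasurePreserving_tile_left one_pos (0 : Fin d → ℤ))
    filter_upwards [hq.ae h] with z hz
    simpa only [Prod.map, untile_tile one_pos] using hz
  · intro h
    have hq := QuasiMeasurePreserving.prodMap (quasiMeasurePreserving_untile_snd (d := d) ha)
      (quasiMeasurePreserving_untile_snd (d := d) one_pos)
    filter_upwards [ae_all_iff.2 fun c => hq.ae (h c)] with z hz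
    have := hz (untile a z.1).1
    simpa only [Prod.map, Prod.mk.eta, tile_untile ha] using this

/-- The Zak transform reads its second argument multiplied by `1/β`, and `(βξ + (β/p)s)/β = ξ +
s/p`. The columns are thus translates by points of order `p`. -/
theorem zzMatrix_eq {d p q : ℕ} {α β : ℝ} (hβ : β ≠ 0) (hα : α = p / (β * q)) (g : L2 d)
    (x ξ : RSpace d) :
    zzMatrix g β p q x ξ = fun (r : Fin d → Fin q) (s : Fin d → Fin p) =>
      zakTorus (1 / β) g (x + α • finVec r, (untile 1 ξ).2 + torusFrac s) := by
  funext r s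
  rw [zzMatrix, zak, hα]
  congr 2
  funext i
  simp only [untile, torusFrac, finVec, Pi.add_apply, ← AddCircle.coe_add, PiLp.add_apply,
    PiLp.smul_apply, smul_eq_mul, div_one]
  congr 1
  field_simp

end GaborRational
end

/-! ### The criterion -/

theorem mainTheorem11 (d : ℕ) (α β : ℝ) (hα : 0 < α) (hβ : 0 < β)
    (p q : ℕ) (hp : 0 < p) (hq : 0 < q)
    (hαβ : α * β = (p : ℝ) / (q : ℝ)) (hle : (p : ℝ) / (q : ℝ) ≤ 1)
    (g : GaborRational.L2 d) :
    GaborRational.IsFrame (GaborRational.gaborSystem g α β) ↔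
      ∃ A B : ℝ, 0 < A ∧ A ≤ B ∧
        ∀ᵐ z : GaborRational.RSpace d × GaborRational.RSpace d,
          ∀ i : ℕ, i < p ^ d →
            (Matrix.toEuclideanLin
              (GaborRational.zzMatrix g β p q z.1 z.2)).singularValues i ∈
                Set.Icc (√A) (√B) := by
  open GaborRational in
  have : NeZero p := ⟨hp.ne'⟩
  have : NeZero q := ⟨hq.ne'⟩
  have hp' : (0 : ℝ) < p := Nat.cast_pos.2 hp
  have hq' : (0 : ℝ) < q := Nat.cast_pos.2 hq
  have ha : 0 < 1 / β := by positivity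
  have hβa : β * (1 / β) = 1 := mul_one_div_cancel hβ.ne'
  have hα1 : α = p / (β * q) := by
    field_simp at hαβ ⊢
    linarith
  have hα2 : α * q = 1 / β * p := by
    rw [hα1]
    field_simp
  have hκ : 0 < (1 / β) ^ d / (p : ℝ) ^ d := by positivity
  have hsing : ∀ A B : ℝ, 0 ≤ A → 0 ≤ B →
      ((∀ᵐ z : RSpace d × RSpace d, ∀ i : ℕ, i < p ^ d →
        (Matrix.toEuclideanLin (zzMatrix g β p q z.1 z.2)).singularValues i ∈
          Set.Icc (√A) (√B)) ↔
      ∀ c, ∀ᵐ z ∂(torusMeasure d).prod (torusMeasure d),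
        MatrixBound (ENNReal.ofReal A) (ENNReal.ofReal B)
          fun (r : Fin d → Fin q) (s : Fin d → Fin p) =>
            zakTile (1 / β) g c (α • finVec r) (z.1, z.2 + torusFrac s)) := fun A B hA hB => by
    refine Iff.trans ?_ (ae_prod_iff_forall_tile ha (P := fun x θ =>
      MatrixBound (ENNReal.ofReal A) (ENNReal.ofReal B)
        fun (r : Fin d → Fin q) (s : Fin d → Fin p) =>
          zakTorus (1 / β) g (x + α • finVec r, θ + torusFrac s)))
    refine eventually_congr (Eventually.of_forall fun z => ?_)
    rw [singularValues_toEuclideanLin_mem_Icc_iff _ (by simp) hA hB,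
      zzMatrix_eq hβ.ne' hα1]
  constructor
  · rintro ⟨A, B, hA, hB, h⟩
    -- Frame bounds are the matrix bounds times `(1/β)^d / p^d`. The maximum supplies `A ≤ B`, which
    -- `IsFrame` does not record.
    refine ⟨A / ((1 / β) ^ d / p ^ d), max (A / ((1 / β) ^ d / p ^ d)) (B / ((1 / β) ^ d / p ^ d)),
      by positivity, le_max_left _ _, (hsing _ _ (by positivity) (by positivity)).2 fun c => ?_⟩
    refine matrixBound_of_frame_bound ha hβa hα2 g c ENNReal.ofReal_ne_top ENNReal.ofReal_ne_top
      fun f => ?_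
    have hf := (frame_inequality_iff _ hA.le hB.le f).1 (h f)
    rw [← ENNReal.ofReal_mul hκ.le, ← ENNReal.ofReal_mul hκ.le, mul_div_cancel₀ _ hκ.ne']
    refine ⟨hf.1, hf.2.trans ?_⟩
    gcongr
    rw [mul_comm, ← div_le_iff₀ hκ]
    exact le_max_right _ _
  · rintro ⟨A, B, hA, hAB, h⟩
    have hB : 0 < B := hA.trans_le hAB
    refine ⟨(1 / β) ^ d / p ^ d * A, (1 / β) ^ d / p ^ d * B, by positivity, by positivity,
      fun f => ?_⟩
    rw [frame_inequality_iff _ (by positivity) (by positivity), ENNReal.ofReal_mul hκ.le,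
      ENNReal.ofReal_mul hκ.le]
    -- A single tile is enough here, because the Zak transform of `f` over one tile determines `f`.
    exact frame_bound_of_matrixBound ha hβa hα2 g 0 ((hsing A B hA.le hB.le).1 h 0) f
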